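/- There is an absolute constant $C>0$ such that the following holds. Let $\mathbb{F}_q$ be any finite field, let $n\geq 0$ be an integer, let $A\subseteq \mathbb{F}_q^n$ be a nonempty set with density $\alpha=|A|/q^n$, and let $\gamma\in(0,1]$. Then there is a nonempty affine subspace $V\subseteq \mathbb{F}_q^n$ (a translate of an $\mathbb{F}_q$-linear subspace) of codimension at most $C\,(\log(2/\alpha))^5(\log(2/\gamma))^4$ such that $$|(A+A)\cap V|\geq (1-\gamma)|V|,$$ where $A+A=\{a+b : a,b\in A\}$. -/

import Mathlib

open scoped Pointwise

noncomputable section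

/-- The density `|A| / |G|` of a subset `A` of a finite type `G`. -/
def setDensity {G : Type*} (A : Set G) : ℝ :=
  (A.ncard : ℝ) / (Nat.card G : ℝ)

/-- The codimension of a nonempty affine subspace `V` of a vector space `E`:
the dimension of the quotient of `E` by the direction of `V`. -/
def affineCodim {F E : Type*} [Field F] [AddCommGroup E] [Module F E]
    (V : AffineSubspace F E) : ℕ :=
  Module.finrank F (E ⧸ V.direction)

end

/-! The proof is a density increment in the style of Kelley and Meka. Suppose `A + A` misses a
proportion `γ` of the group. Off `A + A` the normalised convolution of the balanced function of `A`
equals `-1`, so its moments of even order are at least `γ|G|`. Expanding powers over tuples shows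
that the autocorrelation has even moments at least as large, and that its odd moments are
nonnegative. Hence `A - A` must be unevenly covered from above: `exists_large_moment` gives a moment
of `normCorr A`, of order about `log (2 / γ)`, at least that of the constant `5/4`.

Dependent random choice (`exists_sift`) then finds `B`, an intersection of that many translates of
`A`, such that `normCorr A > 9/8` on almost all differences of `B`. By Croot–Sisask sampling
(`exists_diffAvg_pow_close`), this correlation survives `k` rounds of averaging over `X - X` for a
dense set `X`. On the Fourier side each round multiplies a coefficient by the square of that of `X`,
so with `k` about `log (2 / α)` only frequencies in the large spectrum of `X` matter. Chang's lemma
bounds the codimension of their common kernel `V`, and the Fourier mass of `A` there forces density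
at least `33/32 * α` on a coset of `V` (`exists_increment_of_sift`).

With `β` the density of `B`, one step costs codimension of order `k ^ 2 * log (2 / β) ^ 2`, and `log
(2 / β)` is of order `log (2 / γ) * log (2 / α)`. Density cannot exceed one, so there are at most
about `log (2 / α)` steps, which gives the fifth power. -/

/-- The self-convolution of `h`, with counting measure. -/
def selfConv {G : Type*} [AddCommGroup G] [Fintype G] (h : G → ℝ) (x : G) : ℝ :=
  ∑ y, h y * h (x - y)

/-- The autocorrelation of `h`, with counting measure. -/
def autoCorr {G : Type*} [AddCommGroup G] [Fintype G] (h : G → ℝ) (x : G) : ℝ :=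
  ∑ y, h y * h (y + x)

/-- The real-valued indicator function of a finite set. -/
def ind {G : Type*} [DecidableEq G] (A : Finset G) (x : G) : ℝ := if x ∈ A then 1 else 0

lemma sum_ind {G : Type*} [Fintype G] [DecidableEq G] (A : Finset G) : ∑ x, ind A x = A.card := by
  simp [ind]

/-! ### Moments of self-convolutions and autocorrelations -/

section Moments

variable {G : Type*} [AddCommGroup G] [Fintype G]

lemma sum_sum_add (f : G → ℝ) :
    ∑ d : G, ∑ e : G, f (d + e) = Fintype.card G * ∑ x, f x := by
  have (d : G) : ∑ e : G, f (d + e) = ∑ x, f x := Equiv.sum_comp (Equiv.addLeft d) f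
  simp [this]

lemma sum_sum_sub (f : G → ℝ) :
    ∑ d : G, ∑ e : G, f (e - d) = Fintype.card G * ∑ x, f x := by
  have (d : G) : ∑ e : G, f (e - d) = ∑ x, f x := Equiv.sum_comp (Equiv.subRight d) f
  simp [this]

/-- Every `x` is `e - d` in `|G|` ways. The `p`-th power of `∑ w, h (w + d) * h (w + e)` expands
over `p`-tuples, where the sums over `d` and `e` separate and coincide. -/
lemma card_mul_sum_autoCorr_pow (h : G → ℝ) (p : ℕ) :
    Fintype.card G * ∑ x, autoCorr h x ^ p
      = ∑ w : Fin p → G, (∑ d, ∏ i, h (w i + d)) ^ 2 := by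
  have key (d e : G) : autoCorr h (e - d) = ∑ w, h (w + d) * h (w + e) := by
    rw [autoCorr, ← Equiv.sum_comp (Equiv.addRight d)]
    refine Finset.sum_congr rfl fun y _ => ?_
    simp only [Equiv.coe_addRight]
    congr 2
    abel
  rw [← sum_sum_sub (fun x => autoCorr h x ^ p)]
  simp only [key, Fintype.sum_pow, Finset.prod_mul_distrib, sq, Finset.sum_mul_sum]
  refine (Finset.sum_congr rfl fun e _ => Finset.sum_comm).trans ?_
  rw [Finset.sum_comm]

lemma card_mul_sum_selfConv_pow (h : G → ℝ) (p : ℕ) :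
    Fintype.card G * ∑ x, selfConv h x ^ p
      = ∑ w : Fin p → G, (∑ d, ∏ i, h (w i + d)) * ∑ d, ∏ i, h (-w i + d) := by
  have key (d e : G) : selfConv h (d + e) = ∑ w, h (w + d) * h (-w + e) := by
    rw [selfConv, ← Equiv.sum_comp (Equiv.addRight d)]
    refine Finset.sum_congr rfl fun y _ => ?_
    simp only [Equiv.coe_addRight]
    congr 2
    abel
  rw [← sum_sum_add (fun x => selfConv h x ^ p)]
  simp only [key, Fintype.sum_pow, Finset.prod_mul_distrib, Finset.sum_mul_sum]
  refine (Finset.sum_congr rfl fun e _ => Finset.sum_comm).trans ?_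
  rw [Finset.sum_comm]

/-- A sum of squares by the tuple expansion; the case needed is odd `p`. -/
lemma sum_autoCorr_pow_nonneg (h : G → ℝ) (p : ℕ) : 0 ≤ ∑ x, autoCorr h x ^ p := by
  have hn : (0 : ℝ) < Fintype.card G := by exact_mod_cast Fintype.card_pos
  have := card_mul_sum_autoCorr_pow h p
  refine nonneg_of_mul_nonneg_right (a := (Fintype.card G : ℝ)) ?_ hn
  rw [this]
  exact Finset.sum_nonneg fun _ _ => sq_nonneg _

/-- In the tuple expansions the convolution pairs `w` with `-w`. Apply `2ab ≤ a² + b²` termwise;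
negation permutes the tuples. -/
lemma sum_selfConv_pow_le (h : G → ℝ) (p : ℕ) :
    ∑ x, selfConv h x ^ p ≤ ∑ x, autoCorr h x ^ p := by
  have hn : (0 : ℝ) < Fintype.card G := by exact_mod_cast Fintype.card_pos
  refine le_of_mul_le_mul_left ?_ hn
  rw [card_mul_sum_autoCorr_pow, card_mul_sum_selfConv_pow]
  have hneg : ∑ w : Fin p → G, (∑ d, ∏ i, h (-w i + d)) ^ 2
      = ∑ w : Fin p → G, (∑ d, ∏ i, h (w i + d)) ^ 2 :=
    Equiv.sum_comp (Equiv.neg (Fin p → G)) fun w => (∑ d, ∏ i, h (w i + d)) ^ 2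
  have : ∑ w : Fin p → G, (∑ d, ∏ i, h (w i + d)) * ∑ d, ∏ i, h (-w i + d)
      ≤ ∑ w : Fin p → G, ((∑ d, ∏ i, h (w i + d)) ^ 2 + (∑ d, ∏ i, h (-w i + d)) ^ 2) / 2 :=
    Finset.sum_le_sum fun w _ => by
      nlinarith [sq_nonneg ((∑ d, ∏ i, h (w i + d)) - ∑ d, ∏ i, h (-w i + d))]
  refine this.trans (le_of_eq ?_)
  rw [← Finset.sum_div, Finset.sum_add_distrib, hneg]
  ring

end Moments

/-! ### Unbalancing: from centred to uncentred moments -/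

lemma quad_bound {u : ℝ} (hu : 1.1 ≤ u) :
    5 / 2 * u - 2 ≤ (10 * u - 9) ^ 2 ∧ 5 / 4 * u ≤ (10 * u - 9) ^ 2 := by
  constructor <;> nlinarith

/-- The left side is `t ^ (2m - 1) * (1 + t)`: nonpositive for `t ≤ 0`, and at most `4 ^ (1 - m) ≤ γ
/ 2` for `0 < t ≤ 3/8`. Beyond `3/8` the base `u = (1 + t) * 4/5` exceeds `1.1`, and `u ^ 40`
dominates both `4t²` and `t(1 + t)`; the spare factor `4 ^ (m - 1)` pays for `γ / 2`. -/
lemma unbalancing_pointwise {γ t : ℝ} {m : ℕ} (hm : 1 ≤ m)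
    (hγ : 2 / γ ≤ 4 ^ (m - 1)) (hγ0 : 0 < γ) (ht : -1 ≤ t) :
    t ^ (2 * m) + t ^ (2 * m - 1)
      ≤ γ / 2 + γ / 2 * ((1 + t) * (4 / 5)) ^ (40 * m) := by
  obtain ⟨k, rfl⟩ : ∃ k, m = k + 1 := ⟨m - 1, by omega⟩
  simp only [Nat.add_sub_cancel] at hγ
  have e1 : 2 * (k + 1) - 1 = 2 * k + 1 := by omega
  have e2 : t ^ (2 * (k + 1)) + t ^ (2 * (k + 1) - 1) = (t ^ 2) ^ k * (t * (1 + t)) := by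
    rw [e1]; ring
  have hγ' : 1 ≤ γ / 2 * 4 ^ k := by
    rw [div_le_iff₀ hγ0] at hγ; linarith
  have hpow : 0 ≤ ((1 + t) * (4 / 5)) ^ (40 * (k + 1)) := by
    apply pow_nonneg; linarith
  rw [e2]
  rcases le_or_gt t 0 with h0 | h0
  · have : (t ^ 2) ^ k * (t * (1 + t)) ≤ 0 :=
      mul_nonpos_of_nonneg_of_nonpos (by positivity) (by nlinarith)
    have : 0 ≤ γ / 2 * ((1 + t) * (4 / 5)) ^ (40 * (k + 1)) := by positivity
    linarith
  rcases le_or_gt t (3 / 8) with h1 | h1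
  · have : (t ^ 2) ^ k * (t * (1 + t)) ≤ (1 / 4) ^ k * 1 := by
      gcongr
      · nlinarith
      · nlinarith
    have h4 : ((1 : ℝ) / 4) ^ k ≤ γ / 2 := by
      rw [one_div, inv_pow, inv_le_iff_one_le_mul₀ (by positivity)]
      exact hγ'
    have : 0 ≤ γ / 2 * ((1 + t) * (4 / 5)) ^ (40 * (k + 1)) := by positivity
    linarith
  · set u : ℝ := (1 + t) * (4 / 5) with hu
    have hu1 : 1.1 ≤ u := by rw [hu]; linarith
    have htu : t = 5 / 4 * u - 1 := by rw [hu]; ring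
    have b10 : 1 + 10 * (u - 1) ≤ u ^ 10 := by
      have := one_add_mul_le_pow (a := u - 1) (by linarith) 10
      simpa using this
    have hsq : (10 * u - 9) ^ 2 ≤ u ^ 20 := by
      rw [show 20 = 10 * 2 from rfl, pow_mul]
      exact pow_le_pow_left₀ (by linarith) (by linarith) 2
    have b20 : 2 * t ≤ u ^ 20 := (quad_bound hu1).1.trans' (by linarith) |>.trans hsq
    have c20 : 1 + t ≤ u ^ 20 := (quad_bound hu1).2.trans' (by linarith) |>.trans hsq
    have b40 : 4 * t ^ 2 ≤ u ^ 40 := by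
      calc 4 * t ^ 2 = (2 * t) * (2 * t) := by ring
        _ ≤ u ^ 20 * u ^ 20 := by gcongr
        _ = u ^ 40 := by rw [← pow_add]
    have c40 : t * (1 + t) ≤ u ^ 40 := by
      calc t * (1 + t) ≤ u ^ 20 * u ^ 20 := by gcongr; linarith
        _ = u ^ 40 := by rw [← pow_add]
    have : (4 * t ^ 2) ^ k * (t * (1 + t)) ≤ u ^ (40 * (k + 1)) := by
      rw [mul_add 40, pow_add, pow_mul, mul_one 40]
      gcongr
    have h5 : (t ^ 2) ^ k * (t * (1 + t)) ≤ γ / 2 * ((4 * t ^ 2) ^ k * (t * (1 + t))) := by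
      rw [mul_pow]
      have : 0 ≤ (t ^ 2) ^ k * (t * (1 + t)) := by positivity
      nlinarith
    have h6 : γ / 2 * ((4 * t ^ 2) ^ k * (t * (1 + t))) ≤ γ / 2 * u ^ (40 * (k + 1)) := by
      gcongr
    linarith

section Unbalancing

variable {G : Type*} [AddCommGroup G] [Fintype G] [DecidableEq G]

/-- The normalised autocorrelation of (the uniform measure on) `A`. -/
noncomputable def normCorr (A : Finset G) (x : G) : ℝ :=
  Fintype.card G / (A.card : ℝ) ^ 2 * autoCorr (ind A) x

lemma autoCorr_ind_nonneg (A : Finset G) (x : G) : 0 ≤ autoCorr (ind A) x :=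
  Finset.sum_nonneg fun y _ => by unfold ind; split_ifs <;> simp

lemma normCorr_nonneg (A : Finset G) (x : G) : 0 ≤ normCorr A x :=
  mul_nonneg (by positivity) (autoCorr_ind_nonneg A x)

lemma autoCorr_balanced (A : Finset G) (x : G) :
    autoCorr (fun y => ind A y - A.card / Fintype.card G) x
      = autoCorr (ind A) x - (A.card : ℝ) ^ 2 / Fintype.card G := by
  have hn : (0 : ℝ) < Fintype.card G := by exact_mod_cast Fintype.card_pos
  have h1 : ∑ y, ind A (y + x) = A.card := by
    rw [← sum_ind A]; exact Equiv.sum_comp (Equiv.addRight x) _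
  unfold autoCorr
  simp only [sub_mul, mul_sub, Finset.sum_sub_distrib, ← Finset.mul_sum, ← Finset.sum_mul, h1,
    sum_ind]
  simp
  field_simp
  ring

lemma selfConv_balanced (A : Finset G) (x : G) :
    selfConv (fun y => ind A y - A.card / Fintype.card G) x
      = selfConv (ind A) x - (A.card : ℝ) ^ 2 / Fintype.card G := by
  have hn : (0 : ℝ) < Fintype.card G := by exact_mod_cast Fintype.card_pos
  have h1 : ∑ y, ind A (x - y) = A.card := by
    rw [← sum_ind A]; exact Equiv.sum_comp (Equiv.subLeft x) _
  unfold selfConv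
  simp only [sub_mul, mul_sub, Finset.sum_sub_distrib, ← Finset.mul_sum, ← Finset.sum_mul, h1,
    sum_ind]
  simp
  field_simp
  ring

lemma selfConv_ind_eq_zero {A : Finset G} {x : G} (hx : x ∉ A + A) :
    selfConv (ind A) x = 0 := by
  refine Finset.sum_eq_zero fun y _ => ?_
  unfold ind
  by_cases h1 : y ∈ A <;> by_cases h2 : x - y ∈ A <;> simp [h1, h2]
  exact hx (Finset.mem_add.2 ⟨y, h1, x - y, h2, by abel⟩)

/-- If `A + A` misses a `γ` proportion of the group, then high moments of the normalised
autocorrelation of `A` are large. -/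
lemma exists_large_moment {A : Finset G} (hA : A.Nonempty) {γ : ℝ} (hγ0 : 0 < γ) {m : ℕ}
    (hm : 1 ≤ m) (hγm : 2 / γ ≤ 4 ^ (m - 1))
    (hmiss : γ * Fintype.card G ≤ ((A + A)ᶜ.card : ℝ)) :
    Fintype.card G * (5 / 4 : ℝ) ^ (40 * m) ≤ ∑ x, normCorr A x ^ (40 * m) := by
  have hn : (0 : ℝ) < Fintype.card G := by exact_mod_cast Fintype.card_pos
  have ha : (0 : ℝ) < A.card := by exact_mod_cast hA.card_pos
  set n : ℝ := (Fintype.card G : ℝ) with hndef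
  set a : ℝ := (A.card : ℝ) with hadef
  set h : G → ℝ := fun y => ind A y - a / n with hh
  set c : ℝ := n / a ^ 2 with hc
  have hc0 : 0 < c := by positivity
  have hg (x : G) : c * autoCorr h x = normCorr A x - 1 := by
    rw [hh, autoCorr_balanced, normCorr, hc, ← hndef, ← hadef]
    field_simp
  have heven : γ * n ≤ ∑ x, (normCorr A x - 1) ^ (2 * m) := by
    calc γ * n ≤ ∑ x ∈ (A + A)ᶜ, (1 : ℝ) := by simpa using hmiss
      -- Off `A + A` the normalised convolution of the balanced function is exactly `-1`.
      _ = ∑ x ∈ (A + A)ᶜ, (c * selfConv h x) ^ (2 * m) := by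
          refine Finset.sum_congr rfl fun x hx => ?_
          rw [hh, selfConv_balanced, selfConv_ind_eq_zero (Finset.mem_compl.1 hx),
            pow_mul, hc]
          have : (n / a ^ 2 * (0 - a ^ 2 / n)) ^ 2 = 1 := by field_simp; norm_num [← pow_mul]
          rw [this, one_pow]
      _ ≤ ∑ x, (c * selfConv h x) ^ (2 * m) :=
          Finset.sum_le_sum_of_subset_of_nonneg (Finset.subset_univ _) fun x _ _ => by
            rw [pow_mul]; positivity
      _ ≤ ∑ x, (c * autoCorr h x) ^ (2 * m) := by
          simp only [mul_pow, ← Finset.mul_sum]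
          exact mul_le_mul_of_nonneg_left (sum_selfConv_pow_le h _) (by positivity)
      _ = _ := by simp only [hg]
  -- Adding an odd moment costs nothing and cancels the contribution of values below the mean.
  have hodd : 0 ≤ ∑ x, (normCorr A x - 1) ^ (2 * m - 1) := by
    simp only [← hg, mul_pow, ← Finset.mul_sum]
    exact mul_nonneg (by positivity) (sum_autoCorr_pow_nonneg h _)
  have hpt : ∑ x, ((normCorr A x - 1) ^ (2 * m) + (normCorr A x - 1) ^ (2 * m - 1))
      ≤ ∑ x, (γ / 2 + γ / 2 * (4 / 5) ^ (40 * m) * normCorr A x ^ (40 * m)) := by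
    refine Finset.sum_le_sum fun x _ => ?_
    have := unbalancing_pointwise (t := normCorr A x - 1) hm hγm hγ0
      (by linarith [normCorr_nonneg A x])
    rw [add_sub_cancel, mul_pow] at this
    linarith
  rw [Finset.sum_add_distrib, Finset.sum_add_distrib, ← Finset.mul_sum] at hpt
  simp only [Finset.sum_const, Finset.card_univ, nsmul_eq_mul, ← hndef] at hpt
  have h1 : γ / 2 * n ≤ γ / 2 * ((4 / 5) ^ (40 * m) * ∑ x, normCorr A x ^ (40 * m)) := by
    linarith
  have h2 := le_of_mul_le_mul_left h1 (by positivity)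
  have h3 : (5 / 4 : ℝ) ^ (40 * m) * (4 / 5) ^ (40 * m) = 1 := by
    rw [← mul_pow]; norm_num
  calc n * (5 / 4 : ℝ) ^ (40 * m)
      ≤ ((4 / 5) ^ (40 * m) * ∑ x, normCorr A x ^ (40 * m)) * (5 / 4 : ℝ) ^ (40 * m) := by gcongr
    _ = ((5 / 4 : ℝ) ^ (40 * m) * (4 / 5) ^ (40 * m)) * ∑ x, normCorr A x ^ (40 * m) := by ring
    _ = _ := by rw [h3, one_mul]

end Unbalancing

/-! ### Dependent random choice -/

section Sifting

variable {G : Type*} [AddCommGroup G] [Fintype G] [DecidableEq G]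

/-- The intersection of the translates `A - s i`. -/
def sift {N : ℕ} (A : Finset G) (s : Fin N → G) : Finset G :=
  Finset.univ.filter fun x => ∀ i, x + s i ∈ A

lemma prod_ind_eq {N : ℕ} (A : Finset G) (s : Fin N → G) (x : G) :
    ∏ i, ind A (x + s i) = ind (sift A s) x := by
  simp [ind, sift, Finset.prod_boole]

/-- Both `x` and `y` lie in `sift A s` for exactly `autoCorr (ind A) (y - x) ^ N` choices of `s`, so
random sifting favours differences of high autocorrelation. -/
lemma sum_sift (A : Finset G) (N : ℕ) (f : G → ℝ) :
    ∑ s : Fin N → G, ∑ x ∈ sift A s, ∑ y ∈ sift A s, f (y - x)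
      = Fintype.card G * ∑ z, f z * autoCorr (ind A) z ^ N := by
  have h1 (s : Fin N → G) : ∑ x ∈ sift A s, ∑ y ∈ sift A s, f (y - x)
      = ∑ x, ∑ y, f (y - x) * ((∏ i, ind A (x + s i)) * ∏ i, ind A (y + s i)) := by
    simp only [prod_ind_eq]
    simp [ind, ← ite_and, Finset.sum_ite, Finset.filter_and]
    rw [← Finset.sum_subset (Finset.subset_univ (sift A s))]
    · refine Finset.sum_congr rfl fun x hx => ?_
      simp [hx]
    · intro x _ hx
      simp [hx]
  have key (x y : G) : autoCorr (ind A) (y - x) = ∑ w, ind A (x + w) * ind A (y + w) := by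
    rw [autoCorr, ← Equiv.sum_comp (Equiv.addLeft x)]
    refine Finset.sum_congr rfl fun w _ => ?_
    simp only [Equiv.coe_addLeft]
    congr 2
    abel
  rw [← sum_sum_sub (fun z => f z * autoCorr (ind A) z ^ N)]
  simp only [h1, key, Fintype.sum_pow, Finset.prod_mul_distrib, Finset.mul_sum]
  rw [Finset.sum_comm]
  refine Finset.sum_congr rfl fun x _ => ?_
  rw [Finset.sum_comm]

/-- Dependent random choice: if a high moment of the normalised autocorrelation of `A` is large,
then there is a dense set `B` most of whose differences have normalised autocorrelation
larger than `9 / 8`. -/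
lemma exists_sift {A : Finset G} (hA : A.Nonempty) {N : ℕ} (hN : 80 ≤ N)
    (hmom : Fintype.card G * (5 / 4 : ℝ) ^ N ≤ ∑ x, normCorr A x ^ N) :
    ∃ B : Finset G, ((A.card : ℝ) / Fintype.card G) ^ (2 * N) / 2
        ≤ ((B.card : ℝ) / Fintype.card G) ^ 2 ∧
      ∑ x ∈ B, ∑ y ∈ B, (if normCorr A (y - x) ≤ 9 / 8 then (1 : ℝ) else 0)
        ≤ (B.card : ℝ) ^ 2 / 64 := by
  have hn : (0 : ℝ) < Fintype.card G := by exact_mod_cast Fintype.card_pos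
  have ha : (0 : ℝ) < A.card := by exact_mod_cast hA.card_pos
  set n : ℝ := (Fintype.card G : ℝ) with hndef
  set a : ℝ := (A.card : ℝ) with hadef
  -- With this weight, one lower bound on the sum over pairs of a sifted set gives both conclusions:
  -- the set is large, and at most 1/64 of its pairs are bad.
  set f : G → ℝ := fun z => 1 - 64 * (if normCorr A z ≤ 9 / 8 then (1 : ℝ) else 0) with hf
  have hsmall : ∑ z, (if normCorr A z ≤ 9 / 8 then (1 : ℝ) else 0) * normCorr A z ^ N
      ≤ n * (9 / 8) ^ N := by
    calc _ ≤ ∑ _z : G, ((9 : ℝ) / 8) ^ N := Finset.sum_le_sum fun z _ => by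
          split_ifs with h
          · rw [one_mul]; exact pow_le_pow_left₀ (normCorr_nonneg A z) h N
          · rw [zero_mul]; positivity
      _ = _ := by simp [hndef]
  -- The ratio of the two bases is `9/10`, and `80 ≤ N` makes its power small enough to absorb the
  -- weight 64.
  have h98 : (9 / 8 : ℝ) ^ N ≤ (5 / 4) ^ N / 128 := by
    have : (9 / 8 : ℝ) ^ N = (5 / 4) ^ N * (9 / 10) ^ N := by rw [← mul_pow]; norm_num
    have h9 : (9 / 10 : ℝ) ^ N ≤ 1 / 128 :=
      (pow_le_pow_of_le_one (by norm_num) (by norm_num) hN).trans (by norm_num)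
    rw [this]
    have := mul_le_mul_of_nonneg_left h9 (by positivity : (0 : ℝ) ≤ (5 / 4) ^ N)
    linarith
  have h54 : (1 : ℝ) ≤ (5 / 4) ^ N := one_le_pow₀ (by norm_num)
  have hmain : n / 2 ≤ ∑ z, f z * normCorr A z ^ N := by
    have : ∑ z, f z * normCorr A z ^ N = ∑ z, normCorr A z ^ N
        - 64 * ∑ z, (if normCorr A z ≤ 9 / 8 then (1 : ℝ) else 0) * normCorr A z ^ N := by
      rw [Finset.mul_sum, ← Finset.sum_sub_distrib]
      exact Finset.sum_congr rfl fun z _ => by rw [hf]; ring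
    rw [this]
    have : n * (9 / 8) ^ N ≤ n * ((5 / 4) ^ N / 128) := by gcongr
    nlinarith
  have hsum : ∑ _s : Fin N → G, n ^ 2 * ((a / n) ^ (2 * N) / 2)
      ≤ ∑ s : Fin N → G, ∑ x ∈ sift A s, ∑ y ∈ sift A s, f (y - x) := by
    rw [sum_sift, ← hndef]
    have : ∑ z, f z * normCorr A z ^ N
        = (n / a ^ 2) ^ N * ∑ z, f z * autoCorr (ind A) z ^ N := by
      rw [Finset.mul_sum]
      exact Finset.sum_congr rfl fun z _ => by rw [normCorr, mul_pow]; ring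
    rw [this] at hmain
    simp only [Finset.sum_const, Finset.card_univ, nsmul_eq_mul, Fintype.card_fun,
      Fintype.card_fin, Nat.cast_pow, ← hndef]
    have e : n ^ N * (n ^ 2 * ((a / n) ^ (2 * N) / 2)) = n * ((a ^ 2 / n) ^ N * (n / 2)) := by
      rw [pow_mul, div_pow, div_pow, div_pow, ← pow_mul n 2 N, mul_comm 2 N, pow_mul n N 2]
      field_simp
    have e2 : (a ^ 2 / n) ^ N * (n / a ^ 2) ^ N = 1 := by
      rw [← mul_pow]; field_simp; exact one_pow N
    rw [e]
    gcongr
    calc _ ≤ (a ^ 2 / n) ^ N * ((n / a ^ 2) ^ N * ∑ z, f z * autoCorr (ind A) z ^ N) := by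
          gcongr
      _ = _ := by rw [← mul_assoc, e2, one_mul]
  obtain ⟨s, -, hs⟩ := Finset.exists_le_of_sum_le Finset.univ_nonempty hsum
  have hexp : ∑ x ∈ sift A s, ∑ y ∈ sift A s, f (y - x) = ((sift A s).card : ℝ) ^ 2
      - 64 * ∑ x ∈ sift A s, ∑ y ∈ sift A s,
        (if normCorr A (y - x) ≤ 9 / 8 then (1 : ℝ) else 0) := by
    rw [hf]
    simp only [Finset.sum_sub_distrib, ← Finset.mul_sum]
    simp [sq]
  have hpos : 0 ≤ ∑ x ∈ sift A s, ∑ y ∈ sift A s,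
      (if normCorr A (y - x) ≤ 9 / 8 then (1 : ℝ) else 0) :=
    Finset.sum_nonneg fun x _ => Finset.sum_nonneg fun y _ => by split_ifs <;> norm_num
  have hlow : 0 ≤ n ^ 2 * ((a / n) ^ (2 * N) / 2) := by positivity
  refine ⟨sift A s, ?_, by linarith⟩
  rw [div_pow _ _ 2, le_div_iff₀ (by positivity)]
  linarith

end Sifting

/-! ### Norms with natural exponents -/

section LpNorm

variable {G : Type*} [Fintype G]

/-- The `ℓ^p` norm of a real function on a finite type, for a natural exponent. -/
noncomputable def lpNorm (p : ℕ) (f : G → ℝ) : ℝ := (∑ x, |f x| ^ p) ^ (1 / (p : ℝ))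

lemma lpNorm_nonneg (p : ℕ) (f : G → ℝ) : 0 ≤ lpNorm p f :=
  Real.rpow_nonneg (Finset.sum_nonneg fun _ _ => by positivity) _

lemma lpNorm_pow {p : ℕ} (hp : p ≠ 0) (f : G → ℝ) : lpNorm p f ^ p = ∑ x, |f x| ^ p := by
  unfold lpNorm
  rw [one_div]
  exact Real.rpow_inv_natCast_pow (Finset.sum_nonneg fun _ _ => by positivity) hp

lemma lpNorm_le_of_sum_le {p : ℕ} (hp : p ≠ 0) {f : G → ℝ} {c : ℝ} (hc : 0 ≤ c)
    (h : ∑ x, |f x| ^ p ≤ c ^ p) : lpNorm p f ≤ c :=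
  le_of_pow_le_pow_left₀ hp hc ((lpNorm_pow hp f).trans_le h)

lemma lpNorm_add_le {p : ℕ} (hp : p ≠ 0) (f g : G → ℝ) :
    lpNorm p (f + g) ≤ lpNorm p f + lpNorm p g := by
  have h1 : (1 : ℝ) ≤ p := by exact_mod_cast Nat.one_le_iff_ne_zero.2 hp
  have := Real.Lp_add_le Finset.univ f g h1
  simpa only [lpNorm, Pi.add_apply, Real.rpow_natCast] using this

lemma lpNorm_zero {p : ℕ} (hp : p ≠ 0) : lpNorm p (0 : G → ℝ) = 0 := by
  simp [lpNorm, hp]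

lemma lpNorm_smul {p : ℕ} (hp : p ≠ 0) (c : ℝ) (f : G → ℝ) :
    lpNorm p (c • f) = |c| * lpNorm p f := by
  refine (pow_left_inj₀ (lpNorm_nonneg _ _)
    (mul_nonneg (abs_nonneg _) (lpNorm_nonneg _ _)) hp).1 ?_
  rw [mul_pow, lpNorm_pow hp, lpNorm_pow hp, Finset.mul_sum]
  simp [abs_mul, mul_pow]

lemma lpNorm_sub_comm (p : ℕ) (f g : G → ℝ) : lpNorm p (f - g) = lpNorm p (g - f) := by
  simp only [lpNorm, Pi.sub_apply, abs_sub_comm]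

lemma lpNorm_sum_le {p : ℕ} (hp : p ≠ 0) {ι : Type*} (s : Finset ι) (f : ι → G → ℝ) :
    lpNorm p (∑ i ∈ s, f i) ≤ ∑ i ∈ s, lpNorm p (f i) :=
  Finset.le_sum_of_subadditive _ (lpNorm_zero hp).le (lpNorm_add_le hp) s f

lemma lpNorm_smul_sum_sum_le {p : ℕ} (hp : p ≠ 0) {X : Finset G} (hX : X.Nonempty) {c : ℝ}
    {F : G → G → G → ℝ} (hF : ∀ g ∈ X, ∀ g' ∈ X, lpNorm p (F g g') ≤ c) :
    lpNorm p (((X.card : ℝ) ^ 2)⁻¹ • ∑ g ∈ X, ∑ g' ∈ X, F g g') ≤ c := by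
  have h0 : (0 : ℝ) < X.card := by exact_mod_cast hX.card_pos
  rw [lpNorm_smul hp, abs_of_pos (by positivity), inv_mul_le_iff₀ (by positivity)]
  calc lpNorm p (∑ g ∈ X, ∑ g' ∈ X, F g g')
      ≤ ∑ g ∈ X, ∑ g' ∈ X, lpNorm p (F g g') :=
        (lpNorm_sum_le hp _ _).trans (Finset.sum_le_sum fun g _ => lpNorm_sum_le hp _ _)
    _ ≤ ∑ g ∈ X, ∑ g' ∈ X, c :=
        Finset.sum_le_sum fun g hg => Finset.sum_le_sum fun g' hg' => hF g hg g' hg'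
    _ = _ := by simp; ring

lemma lpNorm_translate [AddCommGroup G] (p : ℕ) (f : G → ℝ) (t : G) :
    lpNorm p (fun x => f (x + t)) = lpNorm p f := by
  unfold lpNorm
  congr 1
  exact Equiv.sum_comp (Equiv.addRight t) fun x => |f x| ^ p

end LpNorm

/-! ### Averaging over translates by a difference set -/

section AveragingOperator

variable {G : Type*} [AddCommGroup G]

/-- Averaging over the translates by differences of elements of `X`. -/
noncomputable def diffAvg (X : Finset G) : (G → ℝ) →ₗ[ℝ] (G → ℝ) where
  toFun f x := (∑ g ∈ X, ∑ g' ∈ X, f (x + (g - g'))) / (X.card : ℝ) ^ 2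
  map_add' f g := by
    ext x
    simp only [Pi.add_apply, Finset.sum_add_distrib, add_div]
  map_smul' c f := by
    ext x
    simp only [Pi.smul_apply, smul_eq_mul, ← Finset.mul_sum, mul_div_assoc, RingHom.id_apply]

lemma diffAvg_apply (X : Finset G) (f : G → ℝ) (x : G) :
    diffAvg X f x = (∑ g ∈ X, ∑ g' ∈ X, f (x + (g - g'))) / (X.card : ℝ) ^ 2 := rfl

lemma diffAvg_eq_smul (X : Finset G) (f : G → ℝ) :
    diffAvg X f
      = ((X.card : ℝ) ^ 2)⁻¹ • ∑ g ∈ X, ∑ g' ∈ X, fun x => f (x + (g - g')) := by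
  ext x
  simp [diffAvg_apply, div_eq_inv_mul]

lemma diffAvg_mono (X : Finset G) {f h : G → ℝ} (hfh : ∀ x, f x ≤ h x) (x : G) :
    diffAvg X f x ≤ diffAvg X h x := by
  rw [diffAvg_apply, diffAvg_apply]
  gcongr
  exact hfh _

lemma diffAvg_pow_mono (X : Finset G) (k : ℕ) {f h : G → ℝ} (hfh : ∀ x, f x ≤ h x) (x : G) :
    (diffAvg X ^ k) f x ≤ (diffAvg X ^ k) h x := by
  induction k generalizing x with
  | zero => simpa using hfh x
  | succ k ih =>
    rw [pow_succ', Module.End.mul_apply, Module.End.mul_apply]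
    exact diffAvg_mono X ih x

lemma diffAvg_pow_translate (X : Finset G) (k : ℕ) (f : G → ℝ) (b x : G) :
    (diffAvg X ^ k) (fun y => f (y - b)) x = (diffAvg X ^ k) f (x - b) := by
  induction k generalizing x with
  | zero => simp
  | succ k ih =>
    rw [pow_succ', Module.End.mul_apply, Module.End.mul_apply, diffAvg_apply, diffAvg_apply]
    simp only [ih]
    congr 1
    refine Finset.sum_congr rfl fun g _ => Finset.sum_congr rfl fun g' _ => ?_
    rw [sub_add_eq_add_sub]

variable [Fintype G]

lemma lpNorm_diffAvg_le {p : ℕ} (hp : p ≠ 0) {X : Finset G} (hX : X.Nonempty) (f : G → ℝ) :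
    lpNorm p (diffAvg X f) ≤ lpNorm p f := by
  rw [diffAvg_eq_smul]
  exact lpNorm_smul_sum_sum_le hp hX fun g _ g' _ => (lpNorm_translate p f _).le

lemma lpNorm_diffAvg_sub_le {p : ℕ} (hp : p ≠ 0) {X : Finset G} (hX : X.Nonempty) {f : G → ℝ}
    {c : ℝ} (h : ∀ g ∈ X, ∀ g' ∈ X, lpNorm p (fun x => f (x + (g - g')) - f x) ≤ c) :
    lpNorm p (diffAvg X f - f) ≤ c := by
  have h0 : (0 : ℝ) < X.card := by exact_mod_cast hX.card_pos
  have e : diffAvg X f - f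
      = ((X.card : ℝ) ^ 2)⁻¹ • ∑ g ∈ X, ∑ g' ∈ X, fun x => f (x + (g - g')) - f x := by
    ext x
    simp [diffAvg_apply]
    field_simp
  rw [e]
  exact lpNorm_smul_sum_sum_le hp hX h

/-- Telescoping: the averaging operator is a contraction, so each further application adds at most
the error of the first. -/
lemma lpNorm_diffAvg_pow_sub_le {p : ℕ} (hp : p ≠ 0) {X : Finset G} (hX : X.Nonempty)
    (f : G → ℝ) (k : ℕ) :
    lpNorm p ((diffAvg X ^ k) f - f) ≤ k * lpNorm p (diffAvg X f - f) := by
  induction k with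
  | zero => simp [lpNorm_zero hp]
  | succ k ih =>
    have e : (diffAvg X ^ (k + 1)) f - f
        = diffAvg X ((diffAvg X ^ k) f - f) + (diffAvg X f - f) := by
      rw [pow_succ', Module.End.mul_apply, map_sub]
      abel
    rw [e]
    refine (lpNorm_add_le hp _ _).trans ?_
    have := lpNorm_diffAvg_le hp hX ((diffAvg X ^ k) f - f)
    push_cast
    linarith

end AveragingOperator

/-! ### Croot–Sisask almost periodicity by random sampling -/

section CrootSisask

/-- Hoeffding's argument: convexity bounds the exponential by its chord on `[-1, 1]`, and the zero
mean removes the linear term. -/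
lemma sum_exp_le {α : Type*} {B : Finset α} {v : α → ℝ} (hv : ∀ b ∈ B, |v b| ≤ 1)
    (hv0 : ∑ b ∈ B, v b = 0) (l : ℝ) :
    ∑ b ∈ B, Real.exp (l * v b) ≤ B.card * Real.exp (l ^ 2 / 2) := by
  calc ∑ b ∈ B, Real.exp (l * v b) ≤ ∑ b ∈ B, (Real.cosh l + v b * Real.sinh l) :=
        Finset.sum_le_sum fun b hb => by
          rw [mul_comm]; exact Real.exp_mul_le_cosh_add_mul_sinh (hv b hb) l
    _ = B.card * Real.cosh l := by
        rw [Finset.sum_add_distrib, ← Finset.sum_mul, hv0]; simp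
    _ ≤ _ := by gcongr; exact Real.cosh_le_exp_half_sq l

lemma sum_exp_sum_le {α : Type*} [DecidableEq α] {B : Finset α} {v : α → ℝ}
    (hv : ∀ b ∈ B, |v b| ≤ 1) (hv0 : ∑ b ∈ B, v b = 0) (l : ℝ) (m : ℕ) :
    ∑ b ∈ Fintype.piFinset (fun _ : Fin m => B), Real.exp (l * ∑ i, v (b i))
      ≤ (B.card : ℝ) ^ m * Real.exp (l ^ 2 * m / 2) := by
  have h1 : ∑ b ∈ Fintype.piFinset (fun _ : Fin m => B), Real.exp (l * ∑ i, v (b i))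
      = (∑ b ∈ B, Real.exp (l * v b)) ^ m := by
    rw [Finset.sum_pow']
    exact Finset.sum_congr rfl fun b _ => by rw [Finset.mul_sum, Real.exp_sum]
  rw [h1]
  calc _ ≤ (B.card * Real.exp (l ^ 2 / 2)) ^ m :=
        pow_le_pow_left₀ (Finset.sum_nonneg fun _ _ => (Real.exp_pos _).le)
          (sum_exp_le hv hv0 l) m
    _ = _ := by rw [mul_pow, ← Real.exp_nat_mul]; congr 2; ring

/-- A Marcinkiewicz–Zygmund inequality for bounded centred variables. -/
lemma sum_pow_sum_le {α : Type*} [DecidableEq α] {B : Finset α} {v : α → ℝ}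
    (hv : ∀ b ∈ B, |v b| ≤ 1) (hv0 : ∑ b ∈ B, v b = 0) {q m : ℕ} (hq : 1 ≤ q) (hm : 1 ≤ m) :
    ∑ b ∈ Fintype.piFinset (fun _ : Fin m => B), (∑ i, v (b i)) ^ (2 * q)
      ≤ (B.card : ℝ) ^ m * (2 * (6 * q * m) ^ q) := by
  have hq0 : (0 : ℝ) < q := by exact_mod_cast hq
  have hm0 : (0 : ℝ) < m := by exact_mod_cast hm
  -- Chosen so that the exponent `l ^ 2 * m / 2` of the moment generating bound is exactly `q`.
  set l : ℝ := Real.sqrt (2 * q / m) with hl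
  have hl2 : l ^ 2 = 2 * q / m := Real.sq_sqrt (by positivity)
  have hl0 : 0 ≤ l := Real.sqrt_nonneg _
  have hpt (Z : ℝ) : l ^ (2 * q) / (2 * q).factorial * Z ^ (2 * q)
      ≤ Real.exp (l * Z) + Real.exp (-l * Z) := by
    have h1 := Real.pow_div_factorial_le_exp (l * |Z|) (by positivity) (2 * q)
    have h2 : Real.exp (l * |Z|) ≤ Real.exp (l * Z) + Real.exp (-l * Z) := by
      rcases abs_cases Z with ⟨h, _⟩ | ⟨h, _⟩ <;> rw [h]
      · linarith [Real.exp_pos (-l * Z)]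
      · rw [mul_neg, ← neg_mul]; linarith [Real.exp_pos (l * Z)]
    have h3 : (l * |Z|) ^ (2 * q) = l ^ (2 * q) * Z ^ (2 * q) := by
      rw [mul_pow, pow_mul |Z|, sq_abs, ← pow_mul]
    rw [h3] at h1
    calc _ = l ^ (2 * q) * Z ^ (2 * q) / (2 * q).factorial := by ring
      _ ≤ _ := h1.trans h2
  have hsum : l ^ (2 * q) / (2 * q).factorial *
      ∑ b ∈ Fintype.piFinset (fun _ : Fin m => B), (∑ i, v (b i)) ^ (2 * q)
      ≤ 2 * (B.card : ℝ) ^ m * Real.exp q := by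
    rw [Finset.mul_sum]
    refine (Finset.sum_le_sum fun b _ => hpt _).trans ?_
    rw [Finset.sum_add_distrib]
    have e : l ^ 2 * m / 2 = q := by rw [hl2]; field_simp
    have h1 := sum_exp_sum_le hv hv0 l m
    have h2 := sum_exp_sum_le hv hv0 (-l) m
    rw [neg_sq] at h2
    rw [e] at h1 h2
    linarith
  have hfac : ((2 * q).factorial : ℝ) ≤ ((2 * q) ^ 2) ^ q := by
    rw [← pow_mul]; exact_mod_cast Nat.factorial_le_pow (2 * q)
  have hfac0 : (0 : ℝ) < (2 * q).factorial := by exact_mod_cast Nat.factorial_pos _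
  have hexp : Real.exp q ≤ 3 ^ q := by
    rw [← mul_one (q : ℝ), Real.exp_nat_mul]
    gcongr
    exact Real.exp_one_lt_three.le
  rw [pow_mul, hl2] at hsum
  set T := ∑ b ∈ Fintype.piFinset (fun _ : Fin m => B), (∑ i, v (b i)) ^ (2 * q)
  have hc : 0 < (2 * q / m : ℝ) ^ q / (2 * q).factorial := by positivity
  refine le_of_mul_le_mul_left (hsum.trans ?_) hc
  have e3 : (2 * q / m : ℝ) ^ q * (6 * q * m) ^ q = 3 ^ q * ((2 * q) ^ 2) ^ q := by
    rw [← mul_pow, ← mul_pow]; congr 1; field_simp; norm_num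
  calc 2 * (B.card : ℝ) ^ m * Real.exp q ≤ 2 * (B.card : ℝ) ^ m * 3 ^ q := by gcongr
    _ = 2 * (B.card : ℝ) ^ m * 3 ^ q * ((2 * q).factorial / (2 * q).factorial) := by
        rw [div_self hfac0.ne', mul_one]
    _ ≤ 2 * (B.card : ℝ) ^ m * 3 ^ q * (((2 * q) ^ 2) ^ q / (2 * q).factorial) := by gcongr
    _ = (B.card : ℝ) ^ m * 2 * (3 ^ q * ((2 * q) ^ 2) ^ q) / (2 * q).factorial := by ring
    _ = _ := by rw [← e3]; ring

variable {G : Type*} [AddCommGroup G]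

/-- The average of `f` over `x - B`. -/
noncomputable def subAvg (B : Finset G) (f : G → ℝ) (x : G) : ℝ :=
  (∑ b ∈ B, f (x - b)) / B.card

variable [Fintype G] [DecidableEq G]

/-- Most samples from `B` give a good `ℓ^{2q}` approximation of `subAvg B f`. -/
lemma exists_good_samples {B : Finset G} (hB : B.Nonempty) {f : G → ℝ} (hf0 : ∀ x, 0 ≤ f x)
    (hf1 : ∀ x, f x ≤ 1) {q m : ℕ} (hq : 1 ≤ q) (hm : 1 ≤ m) :
    ∃ L : Finset (Fin m → G), (B.card : ℝ) ^ m ≤ 2 * L.card ∧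
      ∀ b ∈ L, ∑ x, ((∑ i, f (x - b i)) / m - subAvg B f x) ^ (2 * q)
        ≤ Fintype.card G * (24 * q / m) ^ q := by
  have hb0 : (0 : ℝ) < B.card := by exact_mod_cast hB.card_pos
  have hn : (0 : ℝ) < Fintype.card G := by exact_mod_cast Fintype.card_pos
  have hq0 : (0 : ℝ) < q := by exact_mod_cast hq
  have hm0 : (0 : ℝ) < m := by exact_mod_cast hm
  set Ω := Fintype.piFinset (fun _ : Fin m => B)
  have hΩ : (Ω.card : ℝ) = (B.card : ℝ) ^ m := by simp [Ω]
  set T : (Fin m → G) → ℝ := fun b => ∑ x, (∑ i, (f (x - b i) - subAvg B f x)) ^ (2 * q)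
  -- At least twice the mean of `T`, since `24 = 4 * 6` and `4 ≤ 4 ^ q`; Markov's inequality then
  -- keeps half of the samples.
  set K : ℝ := Fintype.card G * (24 * q * m) ^ q with hK
  have hK0 : 0 < K := by positivity
  have hT0 (b) : 0 ≤ T b := Finset.sum_nonneg fun x _ => by rw [pow_mul]; positivity
  have hphi0 (x : G) : 0 ≤ subAvg B f x :=
    div_nonneg (Finset.sum_nonneg fun _ _ => hf0 _) hb0.le
  have hphi1 (x : G) : subAvg B f x ≤ 1 := by
    rw [subAvg, div_le_one hb0]
    calc _ ≤ ∑ b ∈ B, (1 : ℝ) := Finset.sum_le_sum fun _ _ => hf1 _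
      _ = _ := by simp
  have hsum : ∑ b ∈ Ω, T b ≤ K / 2 * (B.card : ℝ) ^ m := by
    rw [Finset.sum_comm]
    calc _ ≤ ∑ _x : G, (B.card : ℝ) ^ m * (2 * (6 * q * m) ^ q) := by
          refine Finset.sum_le_sum fun x _ => ?_
          refine sum_pow_sum_le (v := fun b => f (x - b) - subAvg B f x) (fun b _ => ?_) ?_ hq hm
          · rw [abs_le]
            constructor <;> linarith [hf0 (x - b), hf1 (x - b), hphi0 x, hphi1 x]
          · rw [Finset.sum_sub_distrib, subAvg]
            simp
            field_simp
            ring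
      _ = Fintype.card G * ((B.card : ℝ) ^ m * (2 * (6 * q * m) ^ q)) := by simp
      _ ≤ _ := by
          have h4 : (4 : ℝ) ≤ 4 ^ q := by
            calc (4 : ℝ) = 4 ^ 1 := by norm_num
              _ ≤ 4 ^ q := pow_le_pow_right₀ (by norm_num) hq
          have e : (24 * q * m : ℝ) ^ q = 4 ^ q * (6 * q * m) ^ q := by
            rw [← mul_pow]; congr 1; ring
          rw [hK, e]
          have : 0 ≤ Fintype.card G * ((B.card : ℝ) ^ m * (6 * q * m) ^ q) := by positivity
          have := mul_le_mul_of_nonneg_right h4 this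
          linarith
  refine ⟨Ω.filter fun b => T b ≤ K, ?_, ?_⟩
  · have h1 : K * (Ω.filter fun b => ¬ T b ≤ K).card ≤ ∑ b ∈ Ω, T b := by
      calc _ = ∑ b ∈ Ω.filter (fun b => ¬ T b ≤ K), K := by simp [mul_comm]
        _ ≤ ∑ b ∈ Ω.filter (fun b => ¬ T b ≤ K), T b :=
            Finset.sum_le_sum fun b hb => (not_le.1 (Finset.mem_filter.1 hb).2).le
        _ ≤ _ := Finset.sum_le_sum_of_subset_of_nonneg (Finset.filter_subset _ _)
            fun b _ _ => hT0 b
    have h2 : ((Ω.filter fun b => T b ≤ K).card : ℝ) + (Ω.filter fun b => ¬ T b ≤ K).card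
        = (B.card : ℝ) ^ m := by
      rw [← hΩ]; exact_mod_cast Finset.card_filter_add_card_filter_not _
    have h3 : K * (Ω.filter fun b => ¬ T b ≤ K).card ≤ K * ((B.card : ℝ) ^ m / 2) := by linarith
    have h4 := le_of_mul_le_mul_left h3 hK0
    linarith
  · intro b hb
    have hb' : T b ≤ K := (Finset.mem_filter.1 hb).2
    have e1 (x : G) : (∑ i, f (x - b i)) / m - subAvg B f x
        = (m : ℝ)⁻¹ * ∑ i, (f (x - b i) - subAvg B f x) := by
      rw [Finset.sum_sub_distrib]
      simp
      field_simp
    simp only [e1, mul_pow, ← Finset.mul_sum]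
    have e2 : (24 * q / m : ℝ) ^ q = (m : ℝ)⁻¹ ^ (2 * q) * (24 * q * m) ^ q := by
      rw [pow_mul, ← mul_pow]; congr 1; field_simp
    rw [e2]
    calc _ ≤ (m : ℝ)⁻¹ ^ (2 * q) * K := by gcongr
      _ = _ := by rw [hK]; ring

/-- Croot–Sisask almost periodicity. -/
lemma exists_almost_periods {B : Finset G} (hB : B.Nonempty) {f : G → ℝ} (hf0 : ∀ x, 0 ≤ f x)
    (hf1 : ∀ x, f x ≤ 1) {q m : ℕ} (hq : 1 ≤ q) (hm : 1 ≤ m) :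
    ∃ X : Finset G, ((B.card : ℝ) / Fintype.card G) ^ m / 2 * Fintype.card G ≤ X.card ∧
      ∃ e : G → ℝ, ∀ g ∈ X, ∑ x, (e x - subAvg B f (x - g)) ^ (2 * q)
        ≤ Fintype.card G * (24 * q / m) ^ q := by
  have hn : (0 : ℝ) < Fintype.card G := by exact_mod_cast Fintype.card_pos
  obtain ⟨L, hL, hLb⟩ := exists_good_samples hB hf0 hf1 hq hm
  -- Double count pairs `(z, g)` whose diagonal shift `z - g` is a good sample. Some `z` has many
  -- such `g`, and its sample mean approximates all the corresponding translates at once.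
  have hcount : ∑ z : Fin m → G, ((Finset.univ.filter fun g : G => (fun i => z i - g) ∈ L).card : ℝ)
      = L.card * Fintype.card G := by
    simp only [Finset.card_filter, Nat.cast_sum]
    rw [Finset.sum_comm]
    have (g : G) : ∑ z : Fin m → G, (((if (fun i => z i - g) ∈ L then 1 else 0 : ℕ)) : ℝ)
        = L.card := by
      rw [← Equiv.sum_comp (Equiv.addRight (fun _ : Fin m => g))]
      simp
    refine (Finset.sum_congr rfl fun g _ => this g).trans ?_
    simp [mul_comm]
  have havg : ∑ _z : Fin m → G, ((B.card : ℝ) / Fintype.card G) ^ m / 2 * Fintype.card G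
      ≤ ∑ z : Fin m → G,
        ((Finset.univ.filter fun g : G => (fun i => z i - g) ∈ L).card : ℝ) := by
    rw [hcount]
    simp only [Finset.sum_const, Finset.card_univ, nsmul_eq_mul, Fintype.card_fun,
      Fintype.card_fin, Nat.cast_pow]
    calc _ = (B.card : ℝ) ^ m / 2 * Fintype.card G := by rw [div_pow]; field_simp
      _ ≤ _ := by gcongr; linarith
  obtain ⟨z, -, hz⟩ := Finset.exists_le_of_sum_le Finset.univ_nonempty havg
  refine ⟨_, hz, fun x => (∑ i, f (x - z i)) / m, fun g hg => ?_⟩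
  have := hLb _ (Finset.mem_filter.1 hg).2
  rw [← Equiv.sum_comp (Equiv.subRight g)] at this
  simpa [sub_sub_sub_cancel_right, sub_sub, add_comm] using this

/-- Iterated almost periodicity, integrated against the uniform measure on `B`. -/
lemma exists_diffAvg_pow_close {B : Finset G} (hB : B.Nonempty) {f : G → ℝ} (hf0 : ∀ x, 0 ≤ f x)
    (hf1 : ∀ x, f x ≤ 1) {q k : ℕ} (hq : 1 ≤ q) (hk : 1 ≤ k)
    (hBq : (Fintype.card G : ℝ) ≤ 4 ^ q * B.card) :
    ∃ X : Finset G, X.Nonempty ∧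
      ((B.card : ℝ) / Fintype.card G) ^ (24 * 65536 * q * k ^ 2) / 2 * Fintype.card G ≤ X.card ∧
      |∑ b ∈ B, ((diffAvg X ^ k) (subAvg B f) b - subAvg B f b)| ≤ (B.card : ℝ) / 64 := by
  have hn : (0 : ℝ) < Fintype.card G := by exact_mod_cast Fintype.card_pos
  have hb0 : (0 : ℝ) < B.card := by exact_mod_cast hB.card_pos
  have hq0 : (0 : ℝ) < q := by exact_mod_cast hq
  have hk0 : (0 : ℝ) < k := by exact_mod_cast hk
  have hp : 2 * q ≠ 0 := by omega
  have hm : 1 ≤ 24 * 65536 * q * k ^ 2 := Nat.one_le_iff_ne_zero.2 (by positivity)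
  obtain ⟨X, hX, e, he⟩ := exists_almost_periods hB hf0 hf1 hq hm
  set φ := subAvg B f
  -- As `65536 = 256 ^ 2`, the sample size makes `24q / m` equal to `ε ^ 2`.
  set ε : ℝ := 1 / (256 * k) with hε
  have hε0 : 0 < ε := by positivity
  have hXne : X.Nonempty := by
    rw [← Finset.card_pos]
    have : (0 : ℝ) < X.card := lt_of_lt_of_le (by positivity) hX
    exact_mod_cast this
  have hεq : (24 * q / (24 * 65536 * q * k ^ 2 : ℕ) : ℝ) ^ q = ε ^ (2 * q) := by
    rw [pow_mul, hε]
    congr 1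
    push_cast
    field_simp
    norm_num
  set δ : ℝ := (Fintype.card G : ℝ) ^ (1 / ((2 * q : ℕ) : ℝ)) * ε with hδ
  have hδ0 : 0 ≤ δ := by positivity
  have hδp : δ ^ (2 * q) = Fintype.card G * ε ^ (2 * q) := by
    rw [hδ, mul_pow, one_div, Real.rpow_inv_natCast_pow hn.le hp]
  have hclose (g) (hg : g ∈ X) : lpNorm (2 * q) (e - fun x => φ (x - g)) ≤ δ := by
    refine lpNorm_le_of_sum_le hp hδ0 ?_
    rw [hδp, ← hεq]
    refine le_trans (le_of_eq ?_) (he g hg)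
    refine Finset.sum_congr rfl fun x _ => ?_
    rw [pow_mul, sq_abs, ← pow_mul]; rfl
  have hper : ∀ g ∈ X, ∀ g' ∈ X, lpNorm (2 * q) (fun x => φ (x + (g - g')) - φ x) ≤ 2 * δ := by
    intro g hg g' hg'
    have e1 : (fun x => φ (x + (g - g')) - φ x)
        = fun x => ((fun y => φ (y - g')) - fun y => φ (y - g)) (x + g) := by
      ext x
      simp only [Pi.sub_apply]
      congr 2 <;> abel
    have e2 : ((fun y => φ (y - g')) - fun y => φ (y - g))
        = (e - fun y => φ (y - g)) + ((fun y => φ (y - g')) - e) := by abel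
    rw [e1, lpNorm_translate, e2]
    refine (lpNorm_add_le hp _ _).trans ?_
    rw [lpNorm_sub_comm _ _ e]
    linarith [hclose g hg, hclose g' hg']
  have hpow : lpNorm (2 * q) ((diffAvg X ^ k) φ - φ) ≤ k * (2 * δ) :=
    (lpNorm_diffAvg_pow_sub_le hp hXne φ k).trans
      (mul_le_mul_of_nonneg_left (lpNorm_diffAvg_sub_le hp hXne hper) hk0.le)
  refine ⟨X, hXne, hX, ?_⟩
  set D : G → ℝ := (diffAvg X ^ k) φ - φ with hD
  have hmean : ((∑ b ∈ B, D b) / B.card) ^ (2 * q) ≤ (∑ b ∈ B, D b ^ (2 * q)) / B.card := by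
    have := Real.pow_arith_mean_le_arith_mean_pow_of_even B (fun _ => (B.card : ℝ)⁻¹) D
      (fun _ _ => by positivity) (by simp [hb0.ne']) (even_two_mul q)
    simpa only [← Finset.mul_sum, div_eq_inv_mul] using this
  have htot : ∑ b ∈ B, D b ^ (2 * q) ≤ Fintype.card G * (2 * k * ε) ^ (2 * q) := by
    calc ∑ b ∈ B, D b ^ (2 * q) ≤ ∑ b, D b ^ (2 * q) :=
          Finset.sum_le_sum_of_subset_of_nonneg (Finset.subset_univ _) fun x _ _ => by
            rw [pow_mul]; positivity
      _ = lpNorm (2 * q) D ^ (2 * q) := by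
          rw [lpNorm_pow hp]
          refine Finset.sum_congr rfl fun x _ => ?_
          rw [pow_mul |D x|, sq_abs, ← pow_mul]
      _ ≤ (k * (2 * δ)) ^ (2 * q) := pow_le_pow_left₀ (lpNorm_nonneg _ _) hpow _
      _ = (2 * k) ^ (2 * q) * δ ^ (2 * q) := by rw [← mul_pow]; congr 1; ring
      _ = _ := by rw [hδp, mul_pow (2 * (k : ℝ))]; ring
  -- Restricting the mean to `B` costs only a factor 2 after taking `2q`-th roots, by `hBq`; and `2
  -- * 2kε = 1/64`.
  have hfin : ((∑ b ∈ B, D b) / B.card) ^ (2 * q) ≤ (1 / 64 : ℝ) ^ (2 * q) := by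
    calc _ ≤ (Fintype.card G * (2 * k * ε) ^ (2 * q)) / B.card := hmean.trans (by gcongr)
      _ ≤ (4 ^ q * B.card * (2 * k * ε) ^ (2 * q)) / B.card := by gcongr
      _ = (2 * (2 * k * ε)) ^ (2 * q) := by
          rw [mul_pow 2, pow_mul 2 2 q]; norm_num; field_simp
      _ = _ := by congr 1; rw [hε]; field_simp; norm_num
  rw [pow_mul, pow_mul] at hfin
  have := le_of_pow_le_pow_left₀ (by omega) (by positivity) hfin
  rw [div_pow, div_le_iff₀ (by positivity)] at this
  refine abs_le_of_sq_le_sq ?_ (by positivity)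
  calc (∑ b ∈ B, D b) ^ 2 ≤ (1 / 64) ^ 2 * (B.card : ℝ) ^ 2 := this
    _ = _ := by ring

end CrootSisask

/-! ### Characters as eigenvectors of the averaging operator -/

section Characters

variable {F E : Type*} [Field F] [AddCommGroup E] [Module F E]

lemma exists_addChar_ne_one (F : Type*) [Field F] [Finite F] : ∃ ψ : AddChar F ℂ, ψ ≠ 1 := by
  obtain ⟨ψ, hψ⟩ := (AddChar.exists_apply_ne_zero (a := (1 : F))).2 one_ne_zero
  exact ⟨ψ, fun h => hψ (by simp [h])⟩

lemma sum_addChar_linear [Fintype E] {ψ : AddChar F ℂ} (hψ : ψ ≠ 1) (ξ : E →ₗ[F] F)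
    [Decidable (ξ = 0)] :
    ∑ x, ψ (ξ x) = if ξ = 0 then (Fintype.card E : ℂ) else 0 := by
  split_ifs with h
  · simp [h]
  · have hne : ψ.compAddMonoidHom ξ.toAddMonoidHom ≠ 1 := by
      obtain ⟨t, ht⟩ := AddChar.ne_one_iff.1 hψ
      obtain ⟨x, hx⟩ := LinearMap.surjective h t
      exact AddChar.ne_one_iff.2 ⟨x, by simpa [hx] using ht⟩
    exact AddChar.sum_eq_zero_of_ne_one hne

/-- The real part of the character of `E` attached to the functional `ξ`. -/
noncomputable def reChar (ψ : AddChar F ℂ) (ξ : E →ₗ[F] F) (x : E) : ℝ := (ψ (ξ x)).re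

/-- The absolute value of the Fourier coefficient at `ξ` of the uniform measure on `X`. -/
noncomputable def fourierAbs (ψ : AddChar F ℂ) (X : Finset E) (ξ : E →ₗ[F] F) : ℝ :=
  ‖∑ g ∈ X, ψ (ξ g)‖ / X.card

lemma fourierAbs_nonneg (ψ : AddChar F ℂ) (X : Finset E) (ξ : E →ₗ[F] F) :
    0 ≤ fourierAbs ψ X ξ := by unfold fourierAbs; positivity

lemma fourierAbs_le_one [Finite F] (ψ : AddChar F ℂ) (X : Finset E) (ξ : E →ₗ[F] F) :
    fourierAbs ψ X ξ ≤ 1 := by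
  refine div_le_one_of_le₀ ((norm_sum_le _ _).trans ?_) (by positivity)
  simp

/-- The sum over `g - g'` factors as a character sum times its conjugate, a real scalar, so it
passes through the real part. Symmetric differences are what make the eigenvalues nonnegative. -/
lemma sum_sum_reChar [Finite F] (ψ : AddChar F ℂ) (X : Finset E) (ξ : E →ₗ[F] F) (x : E) :
    ∑ g ∈ X, ∑ g' ∈ X, reChar ψ ξ (x + (g - g'))
      = ‖∑ g ∈ X, ψ (ξ g)‖ ^ 2 * reChar ψ ξ x := by
  have h : ((‖∑ g ∈ X, ψ (ξ g)‖ ^ 2 : ℝ) : ℂ)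
      = (∑ g ∈ X, ψ (ξ g)) * ∑ g ∈ X, ψ (-(ξ g)) := by
    simp only [AddChar.map_neg_eq_conj, ← map_sum]
    rw [Complex.mul_conj, Complex.normSq_eq_norm_sq]
  rw [reChar, ← Complex.re_ofReal_mul, h, Finset.sum_mul_sum, Finset.sum_mul, Complex.re_sum]
  refine Finset.sum_congr rfl fun g _ => ?_
  rw [Finset.sum_mul, Complex.re_sum]
  refine Finset.sum_congr rfl fun g' _ => ?_
  rw [reChar, map_add, map_sub, sub_eq_add_neg, AddChar.map_add_eq_mul, AddChar.map_add_eq_mul]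
  ring_nf

lemma diffAvg_reChar [Finite F] (ψ : AddChar F ℂ) (X : Finset E) (ξ : E →ₗ[F] F) :
    diffAvg X (reChar ψ ξ) = fourierAbs ψ X ξ ^ 2 • reChar ψ ξ := by
  ext x
  rw [diffAvg_apply, sum_sum_reChar, fourierAbs, Pi.smul_apply, smul_eq_mul, div_pow]
  ring

lemma diffAvg_pow_reChar [Finite F] (ψ : AddChar F ℂ) (X : Finset E) (ξ : E →ₗ[F] F) (k : ℕ) :
    (diffAvg X ^ k) (reChar ψ ξ) = (fourierAbs ψ X ξ ^ 2) ^ k • reChar ψ ξ := by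
  induction k with
  | zero => simp
  | succ k ih =>
    rw [pow_succ', Module.End.mul_apply, ih, map_smul, diffAvg_reChar, smul_smul,
      pow_succ (fourierAbs ψ X ξ ^ 2)]

end Characters

/-! ### Fourier inversion and density on cosets -/

section Inversion

lemma card_dual_eq {F E : Type*} [Field F] [Finite F] [AddCommGroup E] [Module F E] [Fintype E]
    [Fintype (E →ₗ[F] F)] : Fintype.card (E →ₗ[F] F) = Fintype.card E := by
  have : Module.Finite F E := Module.Finite.of_finite
  have := Fintype.ofFinite F
  rw [Module.card_eq_pow_finrank (K := F), Module.card_eq_pow_finrank (K := F) (V := E),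
    Subspace.dual_finrank_eq]

variable {F E : Type*} [Field F] [Finite F] [AddCommGroup E] [Module F E] [Fintype E]
  [DecidableEq E] [Fintype (E →ₗ[F] F)]

lemma sum_reChar_dual {ψ : AddChar F ℂ} (hψ : ψ ≠ 1) (x : E) :
    ∑ ξ : E →ₗ[F] F, reChar ψ ξ x = if x = 0 then (Fintype.card E : ℝ) else 0 := by
  classical
  have h := sum_addChar_linear hψ (Module.Dual.eval F E x)
  have h0 : Module.Dual.eval F E x = 0 ↔ x = 0 := by
    rw [← Module.forall_dual_apply_eq_zero_iff F x]
    exact LinearMap.ext_iff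
  have h1 : ∑ ξ : E →ₗ[F] F, reChar ψ ξ x
      = (∑ ξ : E →ₗ[F] F, ψ (Module.Dual.eval F E x ξ)).re := by
    rw [Complex.re_sum]; rfl
  rw [h1]
  refine (congrArg Complex.re h).trans ?_
  simp only [h0]
  split_ifs
  · rw [Complex.natCast_re]; exact_mod_cast card_dual_eq
  · rfl

/-- Fourier inversion for the normalised autocorrelation. -/
lemma normCorr_eq_sum {ψ : AddChar F ℂ} (hψ : ψ ≠ 1) (A : Finset E) :
    normCorr A = ∑ ξ : E →ₗ[F] F, fourierAbs ψ A ξ ^ 2 • reChar ψ ξ := by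
  ext y
  have h1 : ∑ ξ : E →ₗ[F] F, ‖∑ g ∈ A, ψ (ξ g)‖ ^ 2 * reChar ψ ξ y
      = Fintype.card E * autoCorr (ind A) y := by
    simp only [← sum_sum_reChar]
    rw [Finset.sum_comm]
    have h2 (g : E) (_ : g ∈ A) :
        ∑ ξ : E →ₗ[F] F, ∑ g' ∈ A, reChar ψ ξ (y + (g - g'))
          = Fintype.card E * ind A (g + y) := by
      rw [Finset.sum_comm]
      have h3 (g' : E) : y + (g - g') = 0 ↔ g + y = g' := by
        rw [← add_sub_assoc, sub_eq_zero, add_comm]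
      simp only [sum_reChar_dual hψ, h3]
      simp [ind]
    rw [Finset.sum_congr rfl h2, ← Finset.mul_sum, autoCorr]
    congr 1
    rw [← Finset.sum_subset (Finset.subset_univ A) (fun x _ hx => by simp [ind, hx])]
    exact Finset.sum_congr rfl fun x hx => by simp [ind, hx]
  rw [normCorr, div_mul_eq_mul_div, ← h1, Finset.sum_apply, Finset.sum_div]
  refine Finset.sum_congr rfl fun ξ _ => ?_
  rw [Pi.smul_apply, smul_eq_mul, fourierAbs, div_pow]
  ring

/-- Parseval, read off from inversion at the origin. -/
lemma sum_fourierAbs_sq {ψ : AddChar F ℂ} (hψ : ψ ≠ 1) {A : Finset E} (hA : A.Nonempty) :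
    ∑ ξ : E →ₗ[F] F, fourierAbs ψ A ξ ^ 2 = Fintype.card E / (A.card : ℝ) := by
  have ha : (0 : ℝ) < A.card := by exact_mod_cast hA.card_pos
  have h := congrFun (normCorr_eq_sum hψ A) 0
  have h0 : autoCorr (ind A) 0 = A.card := by
    rw [← sum_ind, autoCorr]
    exact Finset.sum_congr rfl fun x _ => by simp [ind]
  rw [normCorr, h0, Finset.sum_apply] at h
  simp only [Pi.smul_apply, smul_eq_mul, reChar, map_zero, AddChar.map_zero_eq_one,
    Complex.one_re, mul_one] at h
  rw [← h]
  field_simp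

/-- Expand `normCorr A` in eigenvectors of `diffAvg X`. All terms are nonnegative, and those outside
the large spectrum of `X` decay geometrically in `k`. -/
lemma sum_sum_diffAvg_pow_normCorr {ψ : AddChar F ℂ} (hψ : ψ ≠ 1) (A : Finset E)
    {B : Finset E} (hB : B.Nonempty) (X : Finset E) (k : ℕ) :
    ∑ b ∈ B, ∑ b' ∈ B, (diffAvg X ^ k) (normCorr A) (b - b')
      = (B.card : ℝ) ^ 2 * ∑ ξ : E →ₗ[F] F,
        fourierAbs ψ A ξ ^ 2 * ((fourierAbs ψ X ξ ^ 2) ^ k * fourierAbs ψ B ξ ^ 2) := by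
  have hb : (0 : ℝ) < B.card := by exact_mod_cast hB.card_pos
  have h (ξ : E →ₗ[F] F) : ∑ b ∈ B, ∑ b' ∈ B, reChar ψ ξ (b - b')
      = (B.card : ℝ) ^ 2 * fourierAbs ψ B ξ ^ 2 := by
    have := sum_sum_reChar ψ B ξ 0
    simp only [zero_add] at this
    rw [this, fourierAbs, reChar, map_zero, AddChar.map_zero_eq_one, Complex.one_re]
    field_simp
  simp only [normCorr_eq_sum hψ A, map_sum, map_smul, diffAvg_pow_reChar, Finset.sum_apply,
    Pi.smul_apply, smul_eq_mul]
  rw [Finset.mul_sum]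
  refine (Finset.sum_congr rfl fun b _ => Finset.sum_comm).trans ?_
  rw [Finset.sum_comm]
  refine Finset.sum_congr rfl fun ξ _ => ?_
  simp only [← Finset.mul_sum, h]
  ring

/-- If `A` has a lot of Fourier mass on the annihilator of `V`, then some translate of `V`
has a large intersection with `A`. -/
lemma exists_dense_coset {ψ : AddChar F ℂ} (hψ : ψ ≠ 1) {A : Finset E} (hA : A.Nonempty)
    (V : Submodule F E) [Fintype V] {T : Finset (E →ₗ[F] F)} (hT : ∀ ξ ∈ T, ∀ v ∈ V, ξ v = 0)
    {c : ℝ} (hc : c ≤ ∑ ξ ∈ T, fourierAbs ψ A ξ ^ 2) :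
    ∃ x ∈ A, c * (A.card / Fintype.card E) * Fintype.card V
      ≤ ((Finset.univ.filter fun v : V => x + (v : E) ∈ A).card : ℝ) := by
  classical
  have ha : (0 : ℝ) < A.card := by exact_mod_cast hA.card_pos
  have hn : (0 : ℝ) < Fintype.card E := by exact_mod_cast Fintype.card_pos
  -- Summing over `V` keeps only the frequencies that vanish on `V`; those outside `T` contribute
  -- nonnegatively.
  have h1 : c * Fintype.card V ≤ ∑ v : V, normCorr A v := by
    simp only [normCorr_eq_sum hψ A, Finset.sum_apply, Pi.smul_apply, smul_eq_mul]
    rw [Finset.sum_comm]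
    simp only [← Finset.mul_sum]
    have h2 (ξ : E →ₗ[F] F) : ∑ v : V, reChar ψ ξ v
        = if ξ.comp V.subtype = 0 then (Fintype.card V : ℝ) else 0 := by
      have := congrArg Complex.re (sum_addChar_linear hψ (ξ.comp V.subtype))
      rw [Complex.re_sum] at this
      refine Eq.trans ?_ (this.trans ?_)
      · rfl
      · split_ifs
        · exact Complex.natCast_re _
        · rfl
    simp only [h2]
    calc c * Fintype.card V ≤ (∑ ξ ∈ T, fourierAbs ψ A ξ ^ 2) * Fintype.card V := by gcongr
      _ = ∑ ξ ∈ T, fourierAbs ψ A ξ ^ 2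
          * (if ξ.comp V.subtype = 0 then (Fintype.card V : ℝ) else 0) := by
          rw [Finset.sum_mul]
          refine Finset.sum_congr rfl fun ξ hξ => ?_
          rw [if_pos]
          ext v
          exact hT ξ hξ v v.2
      _ ≤ _ := Finset.sum_le_sum_of_subset_of_nonneg (Finset.subset_univ _) fun ξ _ _ => by
          split_ifs <;> positivity
  have h3 : ∑ v : V, normCorr A v = Fintype.card E / (A.card : ℝ) ^ 2 *
      ∑ x ∈ A, ((Finset.univ.filter fun v : V => x + (v : E) ∈ A).card : ℝ) := by
    simp only [normCorr, ← Finset.mul_sum, autoCorr]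
    rw [Finset.sum_comm, ← Finset.sum_subset (Finset.subset_univ A)
      (fun x _ hx => by simp [ind, hx])]
    congr 1
    refine Finset.sum_congr rfl fun x hx => ?_
    simp [ind, hx]
  rw [h3] at h1
  refine Finset.exists_le_of_sum_le hA ?_
  rw [Finset.sum_const, nsmul_eq_mul]
  calc (A.card : ℝ) * (c * (A.card / Fintype.card E) * Fintype.card V)
      = (A.card : ℝ) ^ 2 / Fintype.card E * (c * Fintype.card V) := by ring
    _ ≤ (A.card : ℝ) ^ 2 / Fintype.card E * (Fintype.card E / (A.card : ℝ) ^ 2 *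
      ∑ x ∈ A, ((Finset.univ.filter fun v : V => x + (v : E) ∈ A).card : ℝ)) := by gcongr
    _ = _ := by field_simp

end Inversion

/-! ### Chang's lemma -/

section Chang

variable {F E : Type*} [Field F] [AddCommGroup E] [Module F E]

/-- Dually, a functional on the target that vanishes on the image is a linear relation among the `ξ
i`. -/
lemma surjective_pi_of_linearIndependent {ι : Type*} [Finite ι] {ξ : ι → E →ₗ[F] F}
    (hξ : LinearIndependent F ξ) : Function.Surjective (LinearMap.pi ξ) := by
  classical
  have := Fintype.ofFinite ι
  rw [← LinearMap.dualMap_injective_iff, injective_iff_map_eq_zero]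
  intro φ hφ
  have e (i : ι) : (Pi.single i 1 : ι → F) = fun j => if i = j then 1 else 0 := by
    ext j
    simp [Pi.single_apply, eq_comm]
  have h1 : ∑ i, φ (Pi.single i 1) • ξ i = 0 := by
    ext x
    have h2 := LinearMap.congr_fun hφ x
    rw [LinearMap.dualMap_apply, LinearMap.pi_apply_eq_sum_univ] at h2
    simpa [e, mul_comm] using h2
  have h3 := Fintype.linearIndependent_iff.1 hξ _ h1
  ext i
  simpa using h3 i

/-- Linearly independent functionals are independent uniform random variables: translate by a
preimage `σ t` of each `t` and average over `t`. -/
lemma sum_prod_linearIndependent [Fintype F] [Fintype E] {ι : Type*} [Fintype ι]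
    {ξ : ι → E →ₗ[F] F} (hξ : LinearIndependent F ξ) (H : ι → F → ℝ) :
    (Fintype.card F : ℝ) ^ Fintype.card ι * ∑ x, ∏ i, H i (ξ i x)
      = Fintype.card E * ∏ i, ∑ t, H i t := by
  classical
  choose σ hσ using surjective_pi_of_linearIndependent hξ
  have hσ' (t : ι → F) (i : ι) : ξ i (σ t) = t i := congrFun (hσ t) i
  have h1 (t : ι → F) : ∑ x, ∏ i, H i (ξ i x + t i) = ∑ x, ∏ i, H i (ξ i x) := by
    rw [← Equiv.sum_comp (Equiv.addRight (σ t)) fun x => ∏ i, H i (ξ i x)]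
    simp [hσ']
  have h2 (x : E) : ∑ t : ι → F, ∏ i, H i (ξ i x + t i) = ∏ i, ∑ t, H i t := by
    rw [Finset.prod_univ_sum, Fintype.piFinset_univ]
    exact Equiv.sum_comp (Equiv.addLeft (fun i => ξ i x)) fun t => ∏ i, H i (t i)
  have h3 : ∑ t : ι → F, ∑ x, ∏ i, H i (ξ i x + t i)
      = (Fintype.card F : ℝ) ^ Fintype.card ι * ∑ x, ∏ i, H i (ξ i x) := by
    simp [h1]
  rw [← h3, Finset.sum_comm]
  simp [h2]

/-- Chang's lemma for linearly independent frequencies. -/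
lemma card_le_of_fourierAbs_ge [Fintype F] [Fintype E] {ψ : AddChar F ℂ} (hψ : ψ ≠ 1)
    {ι : Type*} [Fintype ι] {ξ : ι → E →ₗ[F] F} (hξ : LinearIndependent F ξ) {X : Finset E}
    (hX : X.Nonempty) (hspec : ∀ i, 1 / 2 ≤ fourierAbs ψ X (ξ i)) :
    (Fintype.card ι : ℝ) ≤ 8 * Real.log (Fintype.card E / X.card) := by
  have hx : (0 : ℝ) < X.card := by exact_mod_cast hX.card_pos
  have hn : (0 : ℝ) < Fintype.card E := by exact_mod_cast Fintype.card_pos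
  have hF : (0 : ℝ) < Fintype.card F := by exact_mod_cast Fintype.card_pos
  -- Phases rotating each Fourier coefficient of `X` onto the nonnegative axis, so that the real
  -- functions `f i` are large on average over `X`.
  have hc (i : ι) : ∃ c : ℂ, ‖c‖ = 1 ∧
      c * ∑ g ∈ X, ψ (ξ i g) = (‖∑ g ∈ X, ψ (ξ i g)‖ : ℂ) := by
    set z := ∑ g ∈ X, ψ (ξ i g)
    by_cases hz : z = 0
    · exact ⟨1, by simp, by simp [hz]⟩
    · refine ⟨‖z‖ / z, ?_, ?_⟩
      · rw [norm_div, Complex.norm_real, norm_norm, div_self (norm_ne_zero_iff.2 hz)]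
      · field_simp
  choose c hc1 hc2 using hc
  set f : ι → F → ℝ := fun i t => (c i * ψ t).re with hf
  have hf1 (i : ι) (t : F) : |f i t| ≤ 1 := by
    refine (Complex.abs_re_le_norm _).trans ?_
    rw [norm_mul, hc1, AddChar.norm_apply, one_mul]
  have hf0 (i : ι) : ∑ t, f i t = 0 := by
    rw [hf]
    simp only [← Complex.re_sum, ← Finset.mul_sum]
    rw [AddChar.sum_eq_zero_of_ne_one hψ]
    simp
  have hfX (i : ι) : (X.card : ℝ) / 2 ≤ ∑ g ∈ X, f i (ξ i g) := by
    rw [hf]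
    simp only [← Complex.re_sum, ← Finset.mul_sum, hc2, Complex.ofReal_re]
    have := hspec i
    rw [fourierAbs, le_div_iff₀ hx] at this
    linarith
  set d : ℝ := (Fintype.card ι : ℝ) with hd
  have hup : ∑ x : E, Real.exp (1 / 2 * ∑ i, f i (ξ i x)) ≤ Fintype.card E * Real.exp (d / 8) := by
    have h1 := sum_prod_linearIndependent hξ fun i t => Real.exp (1 / 2 * f i t)
    simp only [← Real.exp_sum, ← Finset.mul_sum] at h1
    have h2 : ∏ i, ∑ t, Real.exp (1 / 2 * f i t)
        ≤ (Fintype.card F * Real.exp (1 / 8)) ^ Fintype.card ι := by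
      rw [← Finset.card_univ (α := ι), ← Finset.prod_const]
      refine Finset.prod_le_prod (fun i _ => Finset.sum_nonneg fun t _ => (Real.exp_pos _).le)
        fun i _ => ?_
      have := sum_exp_le (B := Finset.univ) (fun t _ => hf1 i t) (hf0 i) (1 / 2)
      norm_num at this ⊢
      exact this
    rw [mul_pow, ← Real.exp_nat_mul] at h2
    have h3 : (Fintype.card F : ℝ) ^ Fintype.card ι *
        ∑ x : E, Real.exp (1 / 2 * ∑ i, f i (ξ i x))
        ≤ (Fintype.card F : ℝ) ^ Fintype.card ι * (Fintype.card E * Real.exp (d / 8)) := by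
      rw [h1]
      calc _ ≤ Fintype.card E * ((Fintype.card F : ℝ) ^ Fintype.card ι *
            Real.exp (Fintype.card ι * (1 / 8))) := by gcongr
        _ = _ := by rw [hd, mul_one_div]; ring
    exact le_of_mul_le_mul_left h3 (by positivity)
  -- Jensen on `X`, via the tangent line to the exponential at `d / 4`. Against the global bound
  -- with `d / 8`, this forces `d` to be small.
  have hlow : X.card * Real.exp (d / 4) ≤ ∑ x : E, Real.exp (1 / 2 * ∑ i, f i (ξ i x)) := by
    have hs : X.card * (d / 4) ≤ ∑ g ∈ X, 1 / 2 * ∑ i, f i (ξ i g) := by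
      rw [← Finset.mul_sum, Finset.sum_comm]
      have : ∑ _i : ι, (X.card : ℝ) / 2 ≤ ∑ i, ∑ g ∈ X, f i (ξ i g) :=
        Finset.sum_le_sum fun i _ => hfX i
      rw [Finset.sum_const, Finset.card_univ, nsmul_eq_mul] at this
      linarith
    calc X.card * Real.exp (d / 4)
        ≤ Real.exp (d / 4) * (X.card + (∑ g ∈ X, 1 / 2 * ∑ i, f i (ξ i g) - X.card * (d / 4))) := by
          have := mul_nonneg (Real.exp_pos (d / 4)).le (sub_nonneg.2 hs)
          linarith
      _ = ∑ g ∈ X, Real.exp (d / 4) * (1 / 2 * ∑ i, f i (ξ i g) - d / 4 + 1) := by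
          rw [← Finset.mul_sum X _ (Real.exp (d / 4)), Finset.sum_add_distrib,
            Finset.sum_sub_distrib]
          simp
          ring
      _ ≤ ∑ g ∈ X, Real.exp (1 / 2 * ∑ i, f i (ξ i g)) := by
          refine Finset.sum_le_sum fun g _ => ?_
          set y := 1 / 2 * ∑ i, f i (ξ i g)
          have h1 := Real.add_one_le_exp (y - d / 4)
          calc _ ≤ Real.exp (d / 4) * Real.exp (y - d / 4) := by gcongr
            _ = _ := by rw [← Real.exp_add]; congr 1; ring
      _ ≤ _ := Finset.sum_le_sum_of_subset_of_nonneg (Finset.subset_univ _)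
          fun x _ _ => (Real.exp_pos _).le
  have hfin : Real.exp (d / 8) ≤ Fintype.card E / X.card := by
    rw [le_div_iff₀ hx]
    have h1 := hlow.trans hup
    have h2 : Real.exp (d / 4) = Real.exp (d / 8) * Real.exp (d / 8) := by
      rw [← Real.exp_add]; congr 1; ring
    rw [h2, ← mul_assoc] at h1
    have := le_of_mul_le_mul_right h1 (Real.exp_pos _)
    linarith
  have := (Real.le_log_iff_exp_le (by positivity)).2 hfin
  linarith

/-- The joint kernel of the large spectrum of `X` has codimension at most logarithmic in the
inverse density of `X`. -/
lemma finrank_quotient_dualCoannihilator_le [Fintype F] [Fintype E] {ψ : AddChar F ℂ}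
    (hψ : ψ ≠ 1) {X : Finset E} (hX : X.Nonempty) :
    (Module.finrank F (E ⧸ (Submodule.span F
      {ξ : Module.Dual F E | 1 / 2 ≤ fourierAbs ψ X ξ}).dualCoannihilator) : ℝ)
      ≤ 8 * Real.log (Fintype.card E / X.card) := by
  have : Module.Finite F E := Module.Finite.of_finite
  have : Finite (Module.Dual F E) := DFunLike.finite _
  set S : Set (Module.Dual F E) := {ξ | 1 / 2 ≤ fourierAbs ψ X ξ}
  -- A basis of the span taken inside the spectrum; its size is the codimension.
  obtain ⟨b, hbS, hspan, hli⟩ := exists_linearIndependent F S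
  have := Fintype.ofFinite b
  have h1 : Module.finrank F (Submodule.span F S) = Fintype.card b := by
    rw [← hspan, finrank_span_set_eq_card hli, Set.toFinset_card]
  have h2 := Subspace.finrank_add_finrank_dualCoannihilator_eq (Submodule.span F S)
  have h3 := Submodule.finrank_quotient_add_finrank (Submodule.span F S).dualCoannihilator
  have h4 : Module.finrank F (E ⧸ (Submodule.span F S).dualCoannihilator) = Fintype.card b := by
    omega
  rw [h4]
  exact card_le_of_fourierAbs_ge hψ hli hX fun i => hbS i.2

end Chang

/-! ### From sifted differences to a density increment -/

section Increment

variable {F E : Type*} [Field F] [Fintype F] [AddCommGroup E] [Module F E] [Fintype E]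
  [DecidableEq E]

/-- If most differences of `B` have large normalised autocorrelation with respect to `A`, then
`A` has increased density on a coset of a subspace of small codimension. -/
lemma exists_increment_of_sift {A B : Finset E} (hA : A.Nonempty) (hB : B.Nonempty)
    (hsift : ∑ x ∈ B, ∑ y ∈ B, (if normCorr A (y - x) ≤ 9 / 8 then (1 : ℝ) else 0)
      ≤ (B.card : ℝ) ^ 2 / 64) {q k : ℕ} (hq : 1 ≤ q) (hk : 1 ≤ k)
    (hBq : (Fintype.card E : ℝ) ≤ 4 ^ q * B.card)
    (hAk : 32 * (Fintype.card E / A.card : ℝ) ≤ 4 ^ k) :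
    ∃ V : Submodule F E, ∃ x ∈ A,
      33 / 32 * ((A.card : ℝ) / Fintype.card E) * Nat.card V
        ≤ ((Set.ncard {v : V | x + (v : E) ∈ A} : ℕ) : ℝ) ∧
      (Module.finrank F (E ⧸ V) : ℝ)
        ≤ 8 * Real.log (2 / ((B.card : ℝ) / Fintype.card E) ^ (24 * 65536 * q * k ^ 2)) := by
  classical
  have hn : (0 : ℝ) < Fintype.card E := by exact_mod_cast Fintype.card_pos
  have hb0 : (0 : ℝ) < B.card := by exact_mod_cast hB.card_pos
  have : Finite (E →ₗ[F] F) := DFunLike.finite _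
  have := Fintype.ofFinite (E →ₗ[F] F)
  obtain ⟨ψ, hψ⟩ := exists_addChar_ne_one F
  -- Almost periodicity needs a function bounded by one; `9/8 * f` is a minorant of `normCorr A`,
  -- and averaging preserves the order.
  set f : E → ℝ := fun z => if 9 / 8 < normCorr A z then 1 else 0 with hf
  have hf0 (z) : 0 ≤ f z := by rw [hf]; dsimp only; split_ifs <;> norm_num
  have hf1 (z) : f z ≤ 1 := by rw [hf]; dsimp only; split_ifs <;> norm_num
  have hfA (z) : ((9 / 8 : ℝ) • f) z ≤ normCorr A z := by
    rw [Pi.smul_apply, smul_eq_mul, hf]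
    dsimp only
    split_ifs with h
    · linarith
    · linarith [normCorr_nonneg A z]
  obtain ⟨X, hXne, hX, hclose⟩ := exists_diffAvg_pow_close hB hf0 hf1 hq hk hBq
  have hx0 : (0 : ℝ) < X.card := by exact_mod_cast hXne.card_pos
  have hsub : ∑ b ∈ B, subAvg B f b * B.card = ∑ b ∈ B, ∑ b' ∈ B, f (b - b') :=
    Finset.sum_congr rfl fun b _ => by rw [subAvg]; field_simp
  have hf63 : 63 / 64 * (B.card : ℝ) ^ 2 ≤ ∑ b ∈ B, ∑ b' ∈ B, f (b - b') := by
    have h1 : ∑ b ∈ B, ∑ b' ∈ B, f (b - b') = (B.card : ℝ) ^ 2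
        - ∑ x ∈ B, ∑ y ∈ B, (if normCorr A (y - x) ≤ 9 / 8 then (1 : ℝ) else 0) := by
      rw [Finset.sum_comm (s := B) (t := B)]
      have h2 (x y : E) : f (y - x) = 1 - (if normCorr A (y - x) ≤ 9 / 8 then (1 : ℝ) else 0) := by
        rw [hf]
        dsimp only
        by_cases h : normCorr A (y - x) ≤ 9 / 8
        · rw [if_neg (not_lt.2 h), if_pos h]; norm_num
        · rw [if_pos (not_le.1 h), if_neg h]; norm_num
      simp only [h2, Finset.sum_sub_distrib]
      simp [sq]
    rw [h1]; linarith
  have hpw (b : E) : (diffAvg X ^ k) (subAvg B f) b * B.card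
      = ∑ b' ∈ B, (diffAvg X ^ k) f (b - b') := by
    have e : subAvg B f = (B.card : ℝ)⁻¹ • ∑ b' ∈ B, fun y => f (y - b') := by
      ext y
      simp [subAvg, div_eq_inv_mul]
    rw [e, map_smul, map_sum, Pi.smul_apply, Finset.sum_apply, smul_eq_mul]
    simp only [diffAvg_pow_translate]
    field_simp
  -- One 64th was lost to bad pairs, another is lost to averaging.
  have hP62 : 62 / 64 * (B.card : ℝ) ^ 2 ≤ ∑ b ∈ B, ∑ b' ∈ B, (diffAvg X ^ k) f (b - b') := by
    simp only [← hpw]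
    have h1 := (abs_le.1 hclose).1
    rw [← hsub] at hf63
    rw [Finset.sum_sub_distrib] at h1
    rw [← Finset.sum_mul] at hf63 ⊢
    have := mul_le_mul_of_nonneg_right h1 hb0.le
    linarith
  have hPA : 9 / 8 * (62 / 64 * (B.card : ℝ) ^ 2)
      ≤ ∑ b ∈ B, ∑ b' ∈ B, (diffAvg X ^ k) (normCorr A) (b - b') := by
    calc _ ≤ 9 / 8 * ∑ b ∈ B, ∑ b' ∈ B, (diffAvg X ^ k) f (b - b') := by gcongr
      _ = ∑ b ∈ B, ∑ b' ∈ B, (diffAvg X ^ k) ((9 / 8 : ℝ) • f) (b - b') := by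
          simp only [map_smul, Pi.smul_apply, smul_eq_mul, Finset.mul_sum]
      _ ≤ _ := Finset.sum_le_sum fun b _ => Finset.sum_le_sum fun b' _ =>
          diffAvg_pow_mono X k hfA _
  rw [sum_sum_diffAvg_pow_normCorr hψ A hB X k] at hPA
  have hspec : 279 / 256 ≤ ∑ ξ : E →ₗ[F] F,
      fourierAbs ψ A ξ ^ 2 * ((fourierAbs ψ X ξ ^ 2) ^ k * fourierAbs ψ B ξ ^ 2) := by
    refine le_of_mul_le_mul_left (hPA.trans' (le_of_eq ?_)) (by positivity : 0 < (B.card : ℝ) ^ 2)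
    ring
  set T : Finset (E →ₗ[F] F) := Finset.univ.filter fun ξ => 1 / 2 ≤ fourierAbs ψ X ξ with hT
  have hbound : ∑ ξ : E →ₗ[F] F,
      fourierAbs ψ A ξ ^ 2 * ((fourierAbs ψ X ξ ^ 2) ^ k * fourierAbs ψ B ξ ^ 2)
      ≤ ∑ ξ ∈ T, fourierAbs ψ A ξ ^ 2 + (1 / 4) ^ k * ∑ ξ : E →ₗ[F] F, fourierAbs ψ A ξ ^ 2 := by
    rw [hT, Finset.sum_filter, Finset.mul_sum, ← Finset.sum_add_distrib]
    refine Finset.sum_le_sum fun ξ _ => ?_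
    have hB1 : fourierAbs ψ B ξ ^ 2 ≤ 1 :=
      pow_le_one₀ (fourierAbs_nonneg _ _ _) (fourierAbs_le_one _ _ _)
    have hX1 : fourierAbs ψ X ξ ^ 2 ≤ 1 :=
      pow_le_one₀ (fourierAbs_nonneg _ _ _) (fourierAbs_le_one _ _ _)
    have hA0 : 0 ≤ fourierAbs ψ A ξ ^ 2 := sq_nonneg _
    split_ifs with h
    · have : (fourierAbs ψ X ξ ^ 2) ^ k * fourierAbs ψ B ξ ^ 2 ≤ 1 :=
        mul_le_one₀ (pow_le_one₀ (sq_nonneg _) hX1) (sq_nonneg _) hB1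
      have h1 := mul_le_mul_of_nonneg_left this hA0
      have h2 : 0 ≤ (1 / 4 : ℝ) ^ k * fourierAbs ψ A ξ ^ 2 := by positivity
      linarith
    · have h4 : fourierAbs ψ X ξ ^ 2 ≤ 1 / 4 := by
        have := pow_le_pow_left₀ (fourierAbs_nonneg ψ X ξ) (not_le.1 h).le 2
        linarith
      have : (fourierAbs ψ X ξ ^ 2) ^ k * fourierAbs ψ B ξ ^ 2 ≤ (1 / 4) ^ k * 1 :=
        mul_le_mul (pow_le_pow_left₀ (sq_nonneg _) h4 k) hB1 (sq_nonneg _) (by positivity)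
      have h1 := mul_le_mul_of_nonneg_left this hA0
      linarith
  have htail : (1 / 4 : ℝ) ^ k * ∑ ξ : E →ₗ[F] F, fourierAbs ψ A ξ ^ 2 ≤ 1 / 32 := by
    rw [sum_fourierAbs_sq hψ hA, one_div_pow, one_div_mul_eq_div,
      div_le_iff₀ (by positivity)]
    linarith
  set V : Submodule F E := (Submodule.span F
      {ξ : Module.Dual F E | 1 / 2 ≤ fourierAbs ψ X ξ}).dualCoannihilator with hV
  have := Fintype.ofFinite V
  have hTV : ∀ ξ ∈ T, ∀ v ∈ V, ξ v = 0 := fun ξ hξ v hv =>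
    (Submodule.mem_dualCoannihilator v).1 hv ξ
      (Submodule.subset_span (Finset.mem_filter.1 hξ).2)
  -- The mass left on `T` is at least `9/8 * 62/64 - 1/32 = 271/256`, above `33/32`.
  obtain ⟨x, hxA, hx⟩ := exists_dense_coset hψ hA V hTV (c := 33 / 32) (by linarith)
  refine ⟨V, x, hxA, ?_, (finrank_quotient_dualCoannihilator_le hψ hXne).trans ?_⟩
  · have e : {v : V | x + (v : E) ∈ A}
        = ((Finset.univ.filter fun v : V => x + (v : E) ∈ A : Finset V) : Set V) := by
      ext v; simp
    rw [e, Set.ncard_coe_finset, Nat.card_eq_fintype_card]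
    exact hx
  · refine mul_le_mul_of_nonneg_left (Real.log_le_log (by positivity) ?_) (by norm_num)
    rw [div_le_div_iff₀ hx0 (by positivity)]
    linarith

end Increment

/-! ### Choice of parameters in one increment step -/

lemma exp_le_four_pow {x : ℝ} {j : ℕ} (h : x ≤ j) : Real.exp x ≤ 4 ^ j := by
  calc Real.exp x ≤ Real.exp (j * 1) := Real.exp_le_exp.2 (by linarith)
    _ = Real.exp 1 ^ j := Real.exp_nat_mul 1 j
    _ ≤ 4 ^ j := by
        gcongr
        linarith [Real.exp_one_lt_three]

section Step

/-- The density increment step: either `A + A` is almost everything, or `A` has increased density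
on a coset of a subspace of small codimension. -/
lemma exists_density_increment {F E : Type*} [Field F] [Finite F] [AddCommGroup E] [Module F E]
    [Finite E] {A : Set E} (hA : A.Nonempty) {γ : ℝ} (hγ0 : 0 < γ) (hγ1 : γ ≤ 1)
    (hmiss : ((A + A).ncard : ℝ) ≤ (1 - γ) * Nat.card E) :
    ∃ V : Submodule F E, ∃ x ∈ A,
      33 / 32 * setDensity A ≤ setDensity {v : V | x + (v : E) ∈ A} ∧
      (Module.finrank F (E ⧸ V) : ℝ) ≤ 8 * 24 * 65536 * 108 * 4 * 160 ^ 2 *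
        Real.log (2 / γ) ^ 2 * Real.log (2 / setDensity A) ^ 4 := by
  classical
  have := Fintype.ofFinite F
  have := Fintype.ofFinite E
  lift A to Finset E using A.toFinite
  rw [Finset.coe_nonempty] at hA
  rw [← Finset.coe_add, Set.ncard_coe_finset, Nat.card_eq_fintype_card] at hmiss
  have hn : (0 : ℝ) < Fintype.card E := by exact_mod_cast Fintype.card_pos
  have ha : (0 : ℝ) < A.card := by exact_mod_cast hA.card_pos
  have hdens : setDensity (A : Set E) = A.card / Fintype.card E := by
    rw [setDensity, Set.ncard_coe_finset, Nat.card_eq_fintype_card]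
  set α : ℝ := A.card / Fintype.card E with hα
  have hα0 : 0 < α := by positivity
  have hα1 : α ≤ 1 := (div_le_one hn).2 (by exact_mod_cast A.card_le_univ)
  rw [hdens]
  have hlog2 := Real.log_two_gt_d9
  set ℓ := Real.log (2 / γ) with hℓ
  set Λ := Real.log (2 / α) with hΛ
  have hℓ2 : Real.log 2 ≤ ℓ := Real.log_le_log two_pos (by rw [le_div_iff₀ hγ0]; linarith)
  have hΛ2 : Real.log 2 ≤ Λ := Real.log_le_log two_pos (by rw [le_div_iff₀ hα0]; linarith)
  -- the large moment
  set m := ⌈ℓ⌉₊ + 1 with hm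
  have hm1 : 2 ≤ m := by
    have : 0 < ⌈ℓ⌉₊ := Nat.ceil_pos.2 (by linarith)
    omega
  have hmℓ : (m : ℝ) ≤ 4 * ℓ := by
    have := Nat.ceil_lt_add_one (a := ℓ) (by linarith)
    rw [hm]; push_cast; linarith
  have hγm : 2 / γ ≤ 4 ^ (m - 1) := by
    rw [hm, Nat.add_sub_cancel, ← Real.exp_log (show 0 < 2 / γ by positivity)]
    exact exp_le_four_pow (Nat.le_ceil _)
  have hmiss' : γ * Fintype.card E ≤ ((A + A)ᶜ.card : ℝ) := by
    rw [Finset.card_compl, Nat.cast_sub (Finset.card_le_univ _)]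
    linarith
  have hmom := exists_large_moment hA hγ0 (by omega) hγm hmiss'
  -- The bound `2 ≤ m` supplies the required `80 ≤ 40 * m`.
  obtain ⟨B, hBα, hsift⟩ := exists_sift hA (by omega) hmom
  set N := 40 * m with hN
  have hN0 : (1 : ℝ) ≤ N := by exact_mod_cast (by omega : 1 ≤ N)
  have hNℓ : (N : ℝ) ≤ 160 * ℓ := by rw [hN]; push_cast; linarith
  rw [← hα] at hBα
  set β : ℝ := B.card / Fintype.card E with hβ
  have hβα : α ^ N / 2 ≤ β := by
    refine le_of_pow_le_pow_left₀ two_ne_zero (by positivity) (hBα.trans' ?_)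
    rw [div_pow, ← pow_mul, mul_comm N]
    have : 0 ≤ α ^ (2 * N) := by positivity
    linarith
  have hβ0 : 0 < β := hβα.trans_lt' (by positivity)
  have hβ1 : β ≤ 1 := (div_le_one hn).2 (by exact_mod_cast B.card_le_univ)
  have hB : B.Nonempty := by
    rw [Finset.nonempty_iff_ne_empty]
    rintro rfl
    simp [hβ] at hβ0
  have hb0 : (0 : ℝ) < B.card := by exact_mod_cast hB.card_pos
  set M := Real.log (2 / β) with hM
  have hM1 : Real.log (1 / β) = M - Real.log 2 := by
    rw [hM, Real.log_div (by norm_num) hβ0.ne', Real.log_div (by norm_num) hβ0.ne']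
    simp
  have hM2 : Real.log 2 ≤ M := Real.log_le_log two_pos (by rw [le_div_iff₀ hβ0]; linarith)
  have hMΛ : M ≤ 2 * N * Λ := by
    have h1 : M ≤ Real.log (4 / α ^ N) := by
      refine Real.log_le_log (by positivity) ?_
      rw [div_le_div_iff₀ hβ0 (by positivity)]
      linarith
    have h2 : Real.log (4 / α ^ N) = 2 * Real.log 2 + N * (Λ - Real.log 2) := by
      rw [Real.log_div (by norm_num) (by positivity), Real.log_pow, hΛ,
        Real.log_div (by norm_num) hα0.ne', show (4 : ℝ) = 2 ^ 2 by norm_num, Real.log_pow]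
      push_cast
      ring
    have h3 : Real.log 2 ≤ N * Real.log 2 := le_mul_of_one_le_left (by linarith) hN0
    have h4 : N * Real.log 2 ≤ N * Λ := by gcongr
    linarith
  -- the parameters of the almost periodicity argument
  set q := ⌈Real.log (1 / β)⌉₊ + 1 with hq
  have hqM : (q : ℝ) ≤ 3 * M := by
    have := Nat.ceil_lt_add_one (a := Real.log (1 / β)) (by linarith)
    rw [hq]; push_cast; linarith
  have hBq : (Fintype.card E : ℝ) ≤ 4 ^ q * B.card := by
    have h1 : 1 / β ≤ 4 ^ q := by
      rw [← Real.exp_log (show 0 < 1 / β by positivity)]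
      refine exp_le_four_pow ((Nat.le_ceil _).trans ?_)
      rw [hq]; push_cast; linarith
    rw [hβ, one_div_div, div_le_iff₀ hb0] at h1
    exact h1
  -- The extra 2 gives the factor 16 that turns `2 / α ≤ 4 ^ ⌈Λ⌉₊` into `32 / α ≤ 4 ^ k`.
  set k := ⌈Λ⌉₊ + 2 with hk
  have hkΛ : (k : ℝ) ≤ 6 * Λ := by
    have := Nat.ceil_lt_add_one (a := Λ) (by linarith)
    rw [hk]; push_cast; linarith
  have hAk : 32 * (Fintype.card E / A.card : ℝ) ≤ 4 ^ k := by
    have h1 : 2 / α ≤ 4 ^ ⌈Λ⌉₊ := by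
      rw [← Real.exp_log (show 0 < 2 / α by positivity)]
      exact exp_le_four_pow (Nat.le_ceil _)
    have h2 : 2 / α = 2 * (Fintype.card E / A.card : ℝ) := by
      rw [hα]; field_simp
    rw [hk, pow_add]
    linarith
  obtain ⟨V, x, hxA, hinc, hcod⟩ :=
    exists_increment_of_sift (F := F) hA hB hsift (by omega) (by omega) hBq hAk
  refine ⟨V, x, hxA, ?_, hcod.trans ?_⟩
  · rw [setDensity, le_div_iff₀ (by exact_mod_cast Nat.card_pos)]
    exact hinc
  · have hM0 : 0 ≤ M := by linarith
    set r := 24 * 65536 * q * k ^ 2 with hr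
    have hr1 : (1 : ℝ) ≤ r := by
      exact_mod_cast (Nat.one_le_iff_ne_zero.2 (by positivity) : 1 ≤ r)
    have hrM : (r : ℝ) ≤ 24 * 65536 * (3 * M) * (6 * Λ) ^ 2 := by
      have e : (r : ℝ) = 24 * 65536 * q * k ^ 2 := by rw [hr]; push_cast; ring
      rw [e]
      gcongr
    have h1 : Real.log (2 / β ^ r) ≤ r * M := by
      rw [Real.log_div (by norm_num) (by positivity), Real.log_pow, hM,
        Real.log_div (by norm_num) hβ0.ne']
      have : Real.log 2 ≤ r * Real.log 2 := le_mul_of_one_le_left (by linarith) hr1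
      linarith
    have hΛ0 : 0 ≤ Λ := by linarith
    have hℓ0 : 0 ≤ ℓ := by linarith
    calc 8 * Real.log (2 / β ^ r) ≤ 8 * (r * M) := by gcongr
      _ ≤ 8 * ((24 * 65536 * (3 * M) * (6 * Λ) ^ 2) * M) := by gcongr
      _ = 8 * 24 * 65536 * 108 * M ^ 2 * Λ ^ 2 := by ring
      _ ≤ 8 * 24 * 65536 * 108 * (2 * (160 * ℓ) * Λ) ^ 2 * Λ ^ 2 := by
          gcongr
          exact hMΛ.trans (by gcongr)
      _ = _ := by ring

end Step

/-! ### Iterating the increment -/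

section Iteration

universe u

/-- Iterating the density increment. -/
lemma exists_subspace_of_density {F : Type*} [Field F] [Finite F] {γ α₀ : ℝ} (hγ0 : 0 < γ)
    (hγ1 : γ ≤ 1) (hα₀ : 0 < α₀) (j : ℕ) :
    ∀ (E : Type u) [AddCommGroup E] [Module F E] [Finite E] (A : Set E), α₀ ≤ setDensity A →
      1 < setDensity A * (33 / 32) ^ j →
      ∃ (W : Submodule F E) (x : E),
        (Module.finrank F (E ⧸ W) : ℝ) ≤ j * (8 * 24 * 65536 * 108 * 4 * 160 ^ 2 *
          Real.log (2 / γ) ^ 2 * Real.log (2 / α₀) ^ 4) ∧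
        (1 - γ) * Nat.card W ≤ (Set.ncard {w : E | w ∈ W ∧ x + w ∈ A + A} : ℝ) := by
  have hlog2 := Real.log_two_gt_d9
  have hden {E : Type u} [Finite E] [Nonempty E] (A : Set E) : setDensity A ≤ 1 := by
    rw [setDensity, div_le_one (by exact_mod_cast Nat.card_pos)]
    exact_mod_cast Set.ncard_le_card A
  -- Since the density only grows, the cost at the initial lower bound `α₀` covers every step.
  set K : ℝ := 8 * 24 * 65536 * 108 * 4 * 160 ^ 2 * Real.log (2 / γ) ^ 2 * Real.log (2 / α₀) ^ 4
    with hK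
  have hK0 : 0 ≤ K := by positivity
  induction j with
  | zero =>
    intro E _ _ _ A _ h
    have := hden A
    linarith
  | succ j ih =>
    intro E _ _ _ A hA h
    have hA0 : 0 < setDensity A := hα₀.trans_le hA
    have hne : A.Nonempty := by
      rw [Set.nonempty_iff_ne_empty]
      rintro rfl
      simp [setDensity] at hA0
    rcases le_or_gt ((A + A).ncard : ℝ) ((1 - γ) * Nat.card E) with hmiss | hmiss
    · obtain ⟨V, x, -, hinc, hcod⟩ := exists_density_increment (F := F) hne hγ0 hγ1 hmiss
      have hcodK : (Module.finrank F (E ⧸ V) : ℝ) ≤ K := by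
        refine hcod.trans ?_
        have h1 : Real.log (2 / setDensity A) ≤ Real.log (2 / α₀) := by
          refine Real.log_le_log (by positivity) ?_
          gcongr
        have h2 : 0 ≤ Real.log (2 / setDensity A) := by
          refine Real.log_nonneg ?_
          rw [le_div_iff₀ hA0]
          linarith [hden A]
        rw [hK]
        gcongr
      set A' : Set V := {v : V | x + (v : E) ∈ A} with hA'
      obtain ⟨W, y, hW, hWA⟩ := ih V A' (by linarith) (by
        refine h.trans_le ?_
        rw [pow_succ']
        have := mul_le_mul_of_nonneg_right hinc (by positivity : (0 : ℝ) ≤ (33 / 32) ^ j)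
        linarith)
      have hmap : Function.Injective V.subtype := V.injective_subtype
      -- As `x + A'` lies in `A`, the sumset `A' + A'` shifted by `x + x` lies in `A + A`.
      refine ⟨W.map V.subtype, (x + x) + y, ?_, ?_⟩
      · have : Module.Finite F E := Module.Finite.of_finite
        have h1 := Submodule.finrank_quotient_add_finrank V
        have h2 := Submodule.finrank_quotient_add_finrank W
        have h3 := Submodule.finrank_quotient_add_finrank (W.map V.subtype)
        have h4 : Module.finrank F (W.map V.subtype) = Module.finrank F W :=
          (Submodule.equivMapOfInjective V.subtype hmap W).finrank_eq.symm
        have h5 : Module.finrank F (E ⧸ W.map V.subtype)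
            = Module.finrank F (E ⧸ V) + Module.finrank F (V ⧸ W) := by omega
        rw [h5]
        push_cast
        linarith
      · have h1 : Nat.card (W.map V.subtype) = Nat.card W :=
          (Nat.card_congr (Submodule.equivMapOfInjective V.subtype hmap W).toEquiv).symm
        rw [h1]
        refine hWA.trans ?_
        rw [← Set.ncard_image_of_injective _ hmap]
        refine Nat.cast_le.2 (Set.ncard_le_ncard ?_ (Set.toFinite _))
        rintro _ ⟨w, ⟨hwW, hw⟩, rfl⟩
        refine ⟨Submodule.mem_map_of_mem hwW, ?_⟩
        obtain ⟨a, ha, b, hb, hab⟩ := Set.mem_add.1 hw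
        refine Set.mem_add.2 ⟨x + a, ha, x + b, hb, ?_⟩
        have hab' : (a : E) + b = y + w := by exact_mod_cast congrArg Subtype.val hab
        rw [add_add_add_comm, hab', ← add_assoc]
        rfl
    · refine ⟨⊤, 0, ?_, ?_⟩
      · have : Module.finrank F (E ⧸ (⊤ : Submodule F E)) = 0 := by
          have : Module.Finite F E := Module.Finite.of_finite
          have h1 := Submodule.finrank_quotient_add_finrank (⊤ : Submodule F E)
          rw [finrank_top] at h1
          omega
        rw [this, Nat.cast_zero]
        positivity
      · have h1 : Nat.card (⊤ : Submodule F E) = Nat.card E :=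
          Nat.card_congr (Submodule.topEquiv (R := F) (M := E)).toEquiv
        have h2 : {w : E | w ∈ (⊤ : Submodule F E) ∧ 0 + w ∈ A + A} = A + A := by
          ext w; simp
        rw [h1, h2]
        exact hmiss.le

end Iteration

/-! ### The main theorem -/

theorem mainTheorem7 :
    ∃ C : ℝ, 0 < C ∧
      ∀ (F : Type*) [Field F] [Finite F] (n : ℕ) (A : Set (Fin n → F)), A.Nonempty →
        ∀ γ : ℝ, 0 < γ → γ ≤ 1 →
          ∃ V : AffineSubspace F (Fin n → F),
            (V : Set (Fin n → F)).Nonempty ∧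
            (affineCodim V : ℝ) ≤
              C * Real.log (2 / setDensity A) ^ 5 * Real.log (2 / γ) ^ 4 ∧
            (1 - γ) * ((V : Set (Fin n → F)).ncard : ℝ) ≤
              (((A + A) ∩ (V : Set (Fin n → F))).ncard : ℝ) := by
  refine ⟨33 * (8 * 24 * 65536 * 108 * 4 * 160 ^ 2) * 4, by norm_num, ?_⟩
  intro F _ _ n A hA γ hγ0 hγ1
  have hlog2 := Real.log_two_gt_d9
  set α := setDensity A with hα
  have hcard : (0 : ℝ) < Nat.card (Fin n → F) := by exact_mod_cast Nat.card_pos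
  have hα0 : 0 < α := div_pos (by exact_mod_cast hA.ncard_pos) hcard
  have hα1 : α ≤ 1 := (div_le_one hcard).2 (by exact_mod_cast Set.ncard_le_card A)
  set ℓ := Real.log (2 / γ) with hℓ
  set Λ := Real.log (2 / α) with hΛ
  have hℓ2 : Real.log 2 ≤ ℓ := Real.log_le_log two_pos (by rw [le_div_iff₀ hγ0]; linarith)
  have hΛ2 : Real.log 2 ≤ Λ := Real.log_le_log two_pos (by rw [le_div_iff₀ hα0]; linarith)
  have hΛ1 : Real.log (1 / α) = Λ - Real.log 2 := by
    rw [hΛ, Real.log_div (by norm_num) hα0.ne', Real.log_div (by norm_num) hα0.ne']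
    simp
  -- Enough steps to push the density past one, since `exp (1/33) ≤ 33/32`; the added 1 makes the
  -- inequality strict.
  set j := ⌊33 * Real.log (1 / α)⌋₊ + 1 with hj
  have hjΛ : (j : ℝ) ≤ 33 * Λ := by
    have := Nat.floor_le (a := 33 * Real.log (1 / α)) (by linarith)
    rw [hj]; push_cast; linarith
  have hjα : 1 < α * (33 / 32) ^ j := by
    have h1 : Real.exp (1 / 33) ≤ 33 / 32 := by
      have h2 := Real.add_one_le_exp (-(1 / 33 : ℝ))
      have h3 : Real.exp (-(1 / 33 : ℝ)) * Real.exp (1 / 33) = 1 := by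
        rw [← Real.exp_add]; simp
      nlinarith [Real.exp_pos (1 / 33 : ℝ)]
    have h2 : 1 / α < (33 / 32) ^ j := by
      calc 1 / α = Real.exp (Real.log (1 / α)) := (Real.exp_log (by positivity)).symm
        _ < Real.exp (j * (1 / 33)) := by
            refine Real.exp_lt_exp.2 ?_
            have := Nat.lt_floor_add_one (33 * Real.log (1 / α))
            rw [hj]; push_cast; linarith
        _ = Real.exp (1 / 33) ^ j := Real.exp_nat_mul _ _
        _ ≤ _ := by gcongr
    rwa [div_lt_iff₀' hα0] at h2
  obtain ⟨W, x, hW, hWA⟩ :=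
    exists_subspace_of_density (F := F) hγ0 hγ1 hα0 j (Fin n → F) A le_rfl hjα
  have hV : ((AffineSubspace.mk' x W : AffineSubspace F (Fin n → F)) : Set (Fin n → F))
      = (fun w => x + w) '' (W : Set (Fin n → F)) := by
    ext z
    simp only [SetLike.mem_coe, AffineSubspace.mem_mk', vsub_eq_sub, Set.mem_image]
    exact ⟨fun h => ⟨z - x, h, by abel⟩, by rintro ⟨w, hw, rfl⟩; simpa using hw⟩
  refine ⟨AffineSubspace.mk' x W, ⟨x, AffineSubspace.self_mem_mk' x W⟩, ?_, ?_⟩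
  · rw [affineCodim, AffineSubspace.direction_mk']
    refine hW.trans ?_
    have hΛ0 : 0 ≤ Λ := by linarith
    -- The iteration gives the square of `log (2 / γ)`; the fourth power is weaker up to the factor
    -- 4 because `ℓ ≥ log 2 > 1/2`.
    have hℓ4 : ℓ ^ 2 ≤ 4 * ℓ ^ 4 := by
      have h1 : 1 ≤ 4 * ℓ ^ 2 := by nlinarith
      have := mul_le_mul_of_nonneg_left h1 (sq_nonneg ℓ)
      linarith
    calc (j : ℝ) * (8 * 24 * 65536 * 108 * 4 * 160 ^ 2 * ℓ ^ 2 * Λ ^ 4)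
        ≤ (33 * Λ) * (8 * 24 * 65536 * 108 * 4 * 160 ^ 2 * (4 * ℓ ^ 4) * Λ ^ 4) := by gcongr
      _ = _ := by ring
  · have hinj : Function.Injective fun w : Fin n → F => x + w := add_right_injective x
    have h1 : (A + A) ∩ ((fun w => x + w) '' (W : Set (Fin n → F)))
        = (fun w => x + w) '' {w | w ∈ W ∧ x + w ∈ A + A} := by
      ext z
      constructor
      · rintro ⟨hz, w, hw, rfl⟩
        exact ⟨w, ⟨hw, hz⟩, rfl⟩
      · rintro ⟨w, ⟨hw, hz⟩, rfl⟩
        exact ⟨hz, w, hw, rfl⟩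
    rw [hV, h1, Set.ncard_image_of_injective _ hinj, Set.ncard_image_of_injective _ hinj]
    exact hWA
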